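/- For $T>0$, a (bivariate) locally stationary Hawkes process on $[0,T]$ with baseline $(\mu^+,\mu^-)\in[0,\infty)^2$, reproduction function $\alpha:[0,1]\to[0,1)$ and antidiagonal exponential kernel of rate $\beta>0$ is a pair of point processes $N^\pm$ on $[0,T]$, each with positive, strictly increasing jump times, embedded into a Poisson base by thinning: $N^{\pm}_t=\int_{[0,t]}\int_{[0,\infty)}\mathbf 1_{\{x\le\lambda^{\pm}_s\}}\,\pi^{\pm}(ds,dx)$ almost surely for all $t\in[0,T]$, where $\pi^+,\pi^-$ are independent Poisson random measures with unit intensity on $[0,\infty)^2$, $N^\pm$ is nonanticipative with respect to the base (i.e. adapted to a filtration to which $\pi^\pm$ are adapted and with the future points of $\pi^\pm$ independent of its past), and $$\lambda^{\pm}_t=\mu^{\pm}+\int_{[0,t)}\alpha(t/T)\,\beta e^{-\beta(t-s)}\,dN^{\mp}_s .$$ Let $\mu_0\ge 0$, $\Delta\mu>0$, $0\le\alpha_0<1$, $\beta>0$ and $\eta\in[0,1]$. For every $T>0$ let $P^{\eta}_t=N^+_t-N^-_t$, $t\in[0,T]$, where $(N^+,N^-)$ is such a process with baseline $(\mu_0+\Delta\mu,\mu_0)$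 and reproduction function $\alpha(x)=\alpha_0(1-\eta x^2)$, and let $P^0$ be the same price process with $\eta=0$ (constant reproduction rate $\alpha_0$). Then for every $u\in(0,1]$ the numbers of jumps of all the point processes up to time $Tu$ have finite expectation and the price increments are integrable, for each $T>0$, and $$\frac{\mathbb E\big[P^{\eta}_{Tu}-P^{\eta}_0\big]}{\mathbb E\big[P^{0}_{Tu}-P^{0}_0\big]}\;\longrightarrow\;\frac{\operatorname{atanh}(\sqrt{\zeta_0}\,u)}{\sqrt{\zeta_0}\,u}\qquad\text{as }T\to\infty,\qquad \zeta_0=\frac{\alpha_0\,\eta}{1+\alpha_0},$$ where the right-hand side is read as its limiting value $1$ when $\zeta_0=0$. -/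

import Mathlib

open MeasureTheory ProbabilityTheory Filter Topology Set
open scoped NNReal ENNReal

noncomputable section

/-- `π` is a Poisson random measure with intensity measure `ν` under `P`: the numbers of points in
sets of finite intensity are Poisson distributed, and the numbers of points in pairwise disjoint
sets are independent. -/
structure IsPoissonRandomMeasure {Ω E : Type*} [MeasurableSpace Ω] [MeasurableSpace E]
    (P : Measure Ω) (ν : Measure E) (π : Ω → Measure E) : Prop where
  measurable : Measurable π
  law : ∀ B : Set E, MeasurableSet B → ν B ≠ ∞ →
    HasLaw (fun ω => π ω B)
      ((poissonMeasure (ν B).toNNReal).map (fun n : ℕ => (n : ℝ≥0∞))) P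
  indep : ∀ (n : ℕ) (B : Fin n → Set E), (∀ i, MeasurableSet (B i)) →
    Pairwise (Function.onFun Disjoint B) → iIndepFun (fun i ω => π ω (B i)) P

/-- Lebesgue measure on `[0,∞)`. -/
def lebesgueNNReal : Measure ℝ≥0 := (volume : Measure ℝ).comap ((↑) : ℝ≥0 → ℝ)

/-- A Poisson base on `time × mark = [0,∞) × [0,∞)`: independent Poisson random measures
`π k` with unit (Lebesgue) intensity, adapted to the filtration `𝓕` in such a way that the points
after time `t` are independent of `𝓕 t`.  The natural filtration of the base is one such `𝓕`. -/
structure IsPoissonBase {Ω ι : Type*} [mΩ : MeasurableSpace Ω] (P : Measure Ω)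
    (𝓕 : Filtration ℝ≥0 mΩ) (π : ι → Ω → Measure (ℝ≥0 × ℝ≥0)) : Prop where
  poisson : ∀ k, IsPoissonRandomMeasure P (lebesgueNNReal.prod lebesgueNNReal) (π k)
  indep : iIndepFun π P
  adapted : ∀ k (t : ℝ≥0), Measurable[𝓕 t] (fun ω => (π k ω).restrict (Iic t ×ˢ univ))
  future_indep : ∀ t : ℝ≥0,
    Indep (𝓕 t)
      (⨆ k, MeasurableSpace.comap (fun ω => (π k ω).restrict (Ioi t ×ˢ univ)) inferInstance) P

/-- The counting measure `C ↦ ∑ₙ 1{tₙ ∈ C}` of a sequence of jump times in `[0,∞]`; jump times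
equal to `∞` are not counted. -/
def jumpMeasure (τ : ℕ → WithTop ℝ≥0) : Measure ℝ≥0 :=
  Measure.sum fun n => WithTop.recTopCoe 0 (fun t : ℝ≥0 => Measure.dirac t) (τ n)

/-- The jump times are positive and strictly increasing (as long as they are finite). -/
def IsJumpSequence (τ : ℕ → WithTop ℝ≥0) : Prop :=
  0 < τ 0 ∧ ∀ n, τ n < τ (n + 1) ∨ (τ n = ⊤ ∧ τ (n + 1) = ⊤)

/-- The intensity
`λ_{k,t} = μ_k(t/T) + ∑_l ∫_{[0,t)} g(t/T) φ_{kl}(t-s) N_l(ds)`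
of a locally stationary Hawkes process, as a number in `[0,∞]`. -/
def hawkesIntensity {ι : Type*} [Fintype ι] (T : ℝ≥0) (μ : ι → ℝ → ℝ) (g : ℝ → ℝ)
    (φ : ι → ι → ℝ → ℝ) (N : ι → Measure ℝ≥0) (k : ι) (t : ℝ≥0) : ℝ≥0∞ :=
  ENNReal.ofReal (μ k (t / T)) +
    ∑ l, ∫⁻ s in Ico 0 t, ENNReal.ofReal (g (t / T) * φ k l ((t : ℝ) - s)) ∂(N l)

/-- The multivariate point process with jump times `τ k n` (the `n`-th jump of the coordinate `k`)
is a locally stationary Hawkes process on `[0,T]` with baseline `μ`, reproduction function `g` and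
kernel `φ`: it is nonanticipative and embedded by thinning into a Poisson base, that is
`N_{k,t} = ∫_{[0,t]} ∫_{[0,∞)} 1{x ≤ λ_{k,s}} π_k(ds, dx)` with `λ` the Hawkes intensity of
`N` itself. -/
def IsLocallyStationaryHawkes {Ω ι : Type*} [mΩ : MeasurableSpace Ω] [Fintype ι] (P : Measure Ω)
    (T : ℝ≥0) (μ : ι → ℝ → ℝ) (g : ℝ → ℝ) (φ : ι → ι → ℝ → ℝ)
    (τ : ι → ℕ → Ω → WithTop ℝ≥0) : Prop :=
  ∃ (𝓕 : Filtration ℝ≥0 mΩ) (π : ι → Ω → Measure (ℝ≥0 × ℝ≥0)),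
    IsPoissonBase P 𝓕 π ∧
    (∀ k n, IsStoppingTime 𝓕 (τ k n)) ∧
    (∀ᵐ ω ∂P, ∀ k, IsJumpSequence (fun n => τ k n ω)) ∧
    (∀ᵐ ω ∂P, ∀ k, ∀ t ≤ T,
      jumpMeasure (fun n => τ k n ω) (Icc 0 t) =
        π k ω {q : ℝ≥0 × ℝ≥0 | q.1 ≤ t ∧ (q.2 : ℝ≥0∞) ≤
          hawkesIntensity T μ g φ (fun l => jumpMeasure (fun n => τ l n ω)) k q.1})

/-- The antidiagonal exponential kernel with entries `Φ(t,β) = β exp(-β t)`. -/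
def antidiagExpKernel (β : ℝ) : Fin 2 → Fin 2 → ℝ → ℝ := fun k l t =>
  if k = l then 0 else β * Real.exp (-β * t)

/-- The baseline `(μ⁺, μ⁻) = (μ₀ + Δμ, μ₀)`. -/
def directionalBaseline (μ₀ Δμ : ℝ) : Fin 2 → ℝ → ℝ := fun k _ =>
  if k = 0 then μ₀ + Δμ else μ₀

/-- The reproduction rate `α(x) = α₀ (1 - η x²)`. -/
def quadraticRate (α₀ η : ℝ) : ℝ → ℝ := fun x => α₀ * (1 - η * x ^ 2)

/-- The jump times `τ 0` (upward moves) and `τ 1` (downward moves) form a Hawkes price model on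
`[0,T]` with directional flow `Δμ` and reproduction rate `α₀ (1 - η x²)`. -/
def IsHawkesPriceModel {Ω : Type*} [MeasurableSpace Ω] (P : Measure Ω) (T : ℝ≥0)
    (μ₀ Δμ α₀ η β : ℝ) (τ : Fin 2 → ℕ → Ω → WithTop ℝ≥0) : Prop :=
  IsLocallyStationaryHawkes P T (directionalBaseline μ₀ Δμ) (quadraticRate α₀ η)
    (antidiagExpKernel β) τ

/-- The counting process `N_{k,t} = N_k([0,t])`, in `[0,∞]`. -/
def countUpTo {Ω : Type*} (τ : Fin 2 → ℕ → Ω → WithTop ℝ≥0) (k : Fin 2) (t : ℝ≥0) (ω : Ω) :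
    ℝ≥0∞ :=
  jumpMeasure (fun n => τ k n ω) (Icc 0 t)

/-- The price `P_t = N⁺_t - N⁻_t`. -/
def price {Ω : Type*} (τ : Fin 2 → ℕ → Ω → WithTop ℝ≥0) (t : ℝ≥0) (ω : Ω) : ℝ :=
  (countUpTo τ 0 t ω).toReal - (countUpTo τ 1 t ω).toReal

/-- The continuous function `x ↦ atanh x / x`, with value `1` at `0`. -/
def artanhQuotient (x : ℝ) : ℝ := if x = 0 then 1 else Real.artanh x / x

end

/-!
Let `m⁺, m⁻` be the mean intensities of the
up and down jumps. Their difference `d = m⁺ - m⁻` solves the scalar Volterra equation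
`d(t) = Δμ - α(t/T) y(t)` with `y(t) = ∫₀ᵗ β exp(-β(t-s)) d(s) ds`, and `∫₀ᵗ d` is the mean price
increment. As the kernel is exponential, `y' = β (d - y)`, hence
`d = Δμ / (1 + α(·/T)) + h(·/T) y' / β` with `h = α / (1 + α)`. Integrating by parts, the last term
contributes `O(1)` to the integral over `[0, Tu]`, uniformly in `T`
(`abs_integral_sub_le_of_volterra`), so that the mean price increment is
`T ∫₀ᵘ Δμ / (1 + α(x)) dx + O(1)`. For `α(x) = α₀ (1 - η x²)` this integral is an inverse hyperbolic
tangent (`integral_div_one_add_quadraticRate`), and for `η = 0` it is `Δμ u / (1 + α₀)`; the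
quotient is the claimed limit.

The probabilistic part derives the Volterra equation from the thinning representation. Since the
points of the Poisson base after time `t` are independent of the past up to `t`, the mean number of
points in a predictable random set is its mean Lebesgue measure
(`IsPoissonBase.lintegral_thinning`, a monotone class argument from the generators of the
predictable `σ`-algebra). The intensity is predictable because the jump times are stopping times, so
that the mean number of jumps up to a bounded stopping time is the mean of the integrated intensity
(`lintegral_jumpMeasure_truncTime`). Stopped at the minimum of the `n`-th jump times of the two
coordinates, the mean numbers of jumps are finite, and as each jump triggers on average at most
`α₀ < 1` others they are bounded uniformly in `n`. This excludes explosion and gives finite means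
(`IsHawkesPriceModel.lintegral_countUpTo_lt_top`). The mean measure of the jumps then has
density `m^±`, which closes the equation (`IsHawkesPriceModel.exists_meanIntensity`).
-/

/-! ### Lebesgue measure on the half-line -/

theorem NNReal.measurableEmbedding_coe : MeasurableEmbedding ((↑) : ℝ≥0 → ℝ) :=
  MeasurableEmbedding.subtype_coe measurableSet_Ici

theorem map_coe_lebesgueNNReal :
    lebesgueNNReal.map ((↑) : ℝ≥0 → ℝ) = (volume : Measure ℝ).restrict (Ici 0) := by
  rw [lebesgueNNReal, NNReal.measurableEmbedding_coe.map_comap]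
  congr 1
  exact Subtype.range_coe

theorem lebesgueNNReal_apply (s : Set ℝ≥0) :
    lebesgueNNReal s = volume (((↑) : ℝ≥0 → ℝ) '' s) :=
  NNReal.measurableEmbedding_coe.comap_apply _ _

theorem lebesgueNNReal_Iic (t : ℝ≥0) : lebesgueNNReal (Iic t) = t := by
  rw [lebesgueNNReal_apply, NNReal.image_coe_Iic, Real.volume_Icc, sub_zero,
    ENNReal.ofReal_coe_nnreal]

theorem lebesgueNNReal_Icc (t : ℝ≥0) : lebesgueNNReal (Icc 0 t) = t := by
  rw [← lebesgueNNReal_Iic t]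
  congr 1
  ext x
  simp

instance : SigmaFinite lebesgueNNReal :=
  ⟨⟨⟨fun n : ℕ => Iic (n : ℝ≥0), fun _ => trivial,
    fun n => by rw [lebesgueNNReal_Iic]; exact ENNReal.coe_lt_top,
    by
      refine eq_univ_of_forall fun x => ?_
      obtain ⟨n, hn⟩ := exists_nat_ge x
      exact mem_iUnion.2 ⟨n, hn⟩⟩⟩⟩

instance : NullSingletonClass lebesgueNNReal :=
  ⟨fun x => by rw [lebesgueNNReal_apply, image_singleton]; exact Real.volume_singleton⟩

/-! ### Predictable integration against a Poisson base -/

/-- The first moment of the standard Poisson law, as a lower Lebesgue integral. -/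
theorem lintegral_natCast_poissonMeasure (r : ℝ≥0) :
    ∫⁻ n : ℕ, (n : ℝ≥0∞) ∂(poissonMeasure r) = r := by
  have hs : HasSum (fun n : ℕ => Real.exp (-r) * (r : ℝ) ^ n / (n.factorial : ℝ) * n) r := by
    have h1 : HasSum (fun n : ℕ => (r : ℝ) * (Real.exp (-r) * (r : ℝ) ^ n / (n.factorial : ℝ)))
        (r * 1) := (hasSum_one_poissonMeasure r).mul_left _
    rw [mul_one] at h1
    refine (hasSum_nat_add_iff' 1).1 ?_
    simp only [Finset.range_one, Finset.sum_singleton, Nat.cast_zero, mul_zero, sub_zero]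
    have h2 : (fun n : ℕ => Real.exp (-r) * (r : ℝ) ^ (n + 1) / ((n + 1).factorial : ℝ) *
        ((n + 1 : ℕ) : ℝ)) = fun n : ℕ => (r : ℝ) *
          (Real.exp (-r) * (r : ℝ) ^ n / (n.factorial : ℝ)) := by
      funext n
      rw [Nat.factorial_succ]
      push_cast
      have : (n.factorial : ℝ) ≠ 0 := by positivity
      field_simp
      ring
    rw [h2]
    exact h1
  rw [poissonMeasure, lintegral_sum_measure]
  simp only [lintegral_smul_measure, lintegral_dirac, smul_eq_mul]
  calc ∑' n : ℕ, ENNReal.ofReal (Real.exp (-r) * (r : ℝ) ^ n / (n.factorial : ℝ)) * (n : ℝ≥0∞)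
      = ∑' n : ℕ, ENNReal.ofReal (Real.exp (-r) * (r : ℝ) ^ n / (n.factorial : ℝ) * n) := by
        congr 1 with n
        rw [ENNReal.ofReal_mul (by positivity), ENNReal.ofReal_natCast]
    _ = ENNReal.ofReal r := by
        rw [← ENNReal.ofReal_tsum_of_nonneg (fun n => by positivity) hs.summable, hs.tsum_eq]
    _ = r := ENNReal.ofReal_coe_nnreal

/-- Campbell's formula for sets: a Poisson random measure has its intensity as mean measure. -/
theorem IsPoissonRandomMeasure.lintegral_apply {Ω E : Type*} [MeasurableSpace Ω]
    [MeasurableSpace E] {P : Measure Ω} {ν : Measure E} {π : Ω → Measure E}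
    (h : IsPoissonRandomMeasure P ν π) {B : Set E} (hB : MeasurableSet B) (hν : ν B ≠ ∞) :
    ∫⁻ ω, π ω B ∂P = ν B := by
  have hl := h.law B hB hν
  have h1 : ∫⁻ ω, π ω B ∂P = ∫⁻ x, x ∂(P.map fun ω => π ω B) :=
    (lintegral_map' aemeasurable_id hl.aemeasurable).symm
  rw [h1, hl.map_eq, lintegral_map (f := fun x : ℝ≥0∞ => x) measurable_id .of_discrete,
    lintegral_natCast_poissonMeasure, ENNReal.coe_toNNReal hν]

theorem isPiSystem_predictable {Ω : Type*} [mΩ : MeasurableSpace Ω] (𝓕 : Filtration ℝ≥0 mΩ) :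
    IsPiSystem ({s : Set (ℝ≥0 × Ω) | ∃ A, MeasurableSet[𝓕 ⊥] A ∧ s = {⊥} ×ˢ A} ∪
      {s | ∃ i A, MeasurableSet[𝓕 i] A ∧ s = Ioi i ×ˢ A}) := by
  rintro _ (⟨A, hA, rfl⟩ | ⟨i, A, hA, rfl⟩) _ (⟨B, hB, rfl⟩ | ⟨j, B, hB, rfl⟩) -
  · exact Or.inl ⟨A ∩ B, hA.inter hB, by rw [prod_inter_prod, inter_self]⟩
  · refine Or.inl ⟨∅, @MeasurableSet.empty _ (𝓕 ⊥), ?_⟩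
    rw [prod_inter_prod]
    simp
  · refine Or.inl ⟨∅, @MeasurableSet.empty _ (𝓕 ⊥), ?_⟩
    rw [prod_inter_prod]
    simp
  · refine Or.inr ⟨i ⊔ j, A ∩ B, (𝓕.mono le_sup_left _ hA).inter (𝓕.mono le_sup_right _ hB), ?_⟩
    rw [prod_inter_prod, Ioi_inter_Ioi]

theorem predictable_le_prod {Ω : Type*} [mΩ : MeasurableSpace Ω] (𝓕 : Filtration ℝ≥0 mΩ) :
    𝓕.predictable ≤ (inferInstance : MeasurableSpace (ℝ≥0 × Ω)) :=
  measurableSpace_le_predictable_of_measurableSet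
    (fun _ hA => (measurableSet_singleton _).prod (𝓕.le _ _ hA))
    (fun _ _ hA => measurableSet_Ioi.prod (𝓕.le _ _ hA))

theorem isCountablySpanning_predictable {Ω : Type*} [mΩ : MeasurableSpace Ω]
    (𝓕 : Filtration ℝ≥0 mΩ) :
    IsCountablySpanning ({s : Set (ℝ≥0 × Ω) | ∃ A, MeasurableSet[𝓕 ⊥] A ∧ s = {⊥} ×ˢ A} ∪
      {s | ∃ i A, MeasurableSet[𝓕 i] A ∧ s = Ioi i ×ˢ A}) := by
  refine ⟨fun n => if n = 0 then {⊥} ×ˢ univ else Ioi 0 ×ˢ univ, fun n => ?_, ?_⟩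
  · by_cases hn : n = 0
    · simp only [hn, if_true]
      exact Or.inl ⟨univ, @MeasurableSet.univ _ (𝓕 ⊥), rfl⟩
    · simp only [hn, if_false]
      exact Or.inr ⟨0, univ, @MeasurableSet.univ _ (𝓕 0), rfl⟩
  · refine eq_univ_of_forall fun x => mem_iUnion.2 ?_
    rcases eq_or_ne x.1 0 with h | h
    · exact ⟨0, by simp [h]⟩
    · exact ⟨1, by simp [pos_iff_ne_zero, h]⟩

/-- The `ω`-section of a set of (time, state, mark) triples. -/
def markedSection {Ω : Type*} (C : Set ((ℝ≥0 × Ω) × ℝ≥0)) (ω : Ω) : Set (ℝ≥0 × ℝ≥0) :=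
  {q | ((q.1, ω), q.2) ∈ C}

theorem measurableSet_markedSection {Ω : Type*} [mΩ : MeasurableSpace Ω]
    {C : Set ((ℝ≥0 × Ω) × ℝ≥0)} (hC : MeasurableSet C) (ω : Ω) :
    MeasurableSet (markedSection C ω) := by
  have : Measurable fun q : ℝ≥0 × ℝ≥0 => ((q.1, ω), q.2) := by fun_prop
  exact this hC

theorem measurableSet_of_predictable_prod {Ω : Type*} [mΩ : MeasurableSpace Ω]
    {𝓕 : Filtration ℝ≥0 mΩ} {C : Set ((ℝ≥0 × Ω) × ℝ≥0)}
    (hC : MeasurableSet[𝓕.predictable.prod inferInstance] C) : MeasurableSet C := by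
  refine (?_ : 𝓕.predictable.prod inferInstance ≤ Prod.instMeasurableSpace) _ hC
  exact sup_le_sup (MeasurableSpace.comap_mono (predictable_le_prod 𝓕)) le_rfl

theorem measurable_lintegral_markedSection {Ω : Type*} [mΩ : MeasurableSpace Ω]
    {C : Set ((ℝ≥0 × Ω) × ℝ≥0)} (hC : MeasurableSet C) (D : Set (ℝ≥0 × ℝ≥0))
    (hD : MeasurableSet D) :
    Measurable fun ω => (lebesgueNNReal.prod lebesgueNNReal) (markedSection C ω ∩ D) := by
  have h1 : Measurable fun p : Ω × (ℝ≥0 × ℝ≥0) => ((p.2.1, p.1), p.2.2) := by fun_prop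
  exact measurable_measure_prodMk_left
    (ν := lebesgueNNReal.prod lebesgueNNReal) ((h1 hC).inter (measurable_snd hD))

/-- Independence of the future points from the past gives the predictable intensity formula on the
rectangles that generate the predictable `σ`-algebra. -/
theorem IsPoissonBase.lintegral_indicator_Ioc_prod {Ω ι : Type*} [mΩ : MeasurableSpace Ω]
    {P : Measure Ω} {𝓕 : Filtration ℝ≥0 mΩ} {π : ι → Ω → Measure (ℝ≥0 × ℝ≥0)}
    (h : IsPoissonBase P 𝓕 π) (k : ι) {A : Set Ω} {i t : ℝ≥0} (hA : MeasurableSet[𝓕 i] A)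
    {B : Set ℝ≥0} (hB : MeasurableSet B) (hB' : lebesgueNNReal B ≠ ∞) :
    ∫⁻ ω, A.indicator 1 ω * π k ω (Ioc i t ×ˢ B) ∂P =
      ∫⁻ ω, A.indicator 1 ω * (lebesgueNNReal.prod lebesgueNNReal) (Ioc i t ×ˢ B) ∂P := by
  have hm : MeasurableSet (Ioc i t ×ˢ B) := measurableSet_Ioc.prod hB
  have hfut : (⨆ k, MeasurableSpace.comap (fun ω => (π k ω).restrict (Ioi i ×ˢ univ))
      inferInstance) ≤ mΩ := by
    refine iSup_le fun l => Measurable.comap_le ?_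
    refine Measure.measurable_of_measurable_coe _ fun D hD => ?_
    simp only [Measure.restrict_apply hD]
    exact (Measure.measurable_coe (hD.inter (measurableSet_Ioi.prod MeasurableSet.univ))).comp
      (h.poisson l).measurable
  have hg : Measurable[⨆ k, MeasurableSpace.comap (fun ω => (π k ω).restrict (Ioi i ×ˢ univ))
      inferInstance] fun ω => π k ω (Ioc i t ×ˢ B) := by
    have h1 : (fun ω => π k ω (Ioc i t ×ˢ B)) =
        (fun μ : Measure (ℝ≥0 × ℝ≥0) => μ (Ioc i t ×ˢ B)) ∘
          fun ω => (π k ω).restrict (Ioi i ×ˢ univ) := by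
      ext ω
      rw [Function.comp_apply, Measure.restrict_apply hm]
      congr 1
      rw [prod_inter_prod, inter_univ, inter_eq_left.2 Ioc_subset_Ioi_self]
    rw [h1]
    refine (Measure.measurable_coe hm).comp ?_
    exact Measurable.of_comap_le (le_iSup (fun l => MeasurableSpace.comap
      (fun ω => (π l ω).restrict (Ioi i ×ˢ univ)) inferInstance) k)
  have hf : Measurable[𝓕 i] (A.indicator (1 : Ω → ℝ≥0∞)) :=
    (@measurable_const _ _ _ (𝓕 i) 1).indicator hA
  have hfin : (lebesgueNNReal.prod lebesgueNNReal) (Ioc i t ×ˢ B) ≠ ∞ := by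
    rw [Measure.prod_prod]
    refine ENNReal.mul_ne_top (ne_top_of_le_ne_top ?_ (measure_mono (Ioc_subset_Iic_self))) hB'
    rw [lebesgueNNReal_Iic]
    exact ENNReal.coe_ne_top
  rw [lintegral_mul_eq_lintegral_mul_lintegral_of_independent_measurableSpace (𝓕.le i) hfut
    (h.future_indep i) hf hg, (h.poisson k).lintegral_apply hm hfin,
    lintegral_mul_const _ (hf.mono (𝓕.le i) le_rfl)]

/-- The predictable intensity formula on a bounded box of times and marks. On the box the base has
finite mean mass, so that complements can be taken in the monotone class argument. -/
theorem IsPoissonBase.lintegral_markedSection_box {Ω ι : Type*} [mΩ : MeasurableSpace Ω]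
    {P : Measure Ω} [IsProbabilityMeasure P]
    {𝓕 : Filtration ℝ≥0 mΩ} {π : ι → Ω → Measure (ℝ≥0 × ℝ≥0)}
    (h : IsPoissonBase P 𝓕 π) (k : ι) (t m : ℝ≥0) (C : Set ((ℝ≥0 × Ω) × ℝ≥0))
    (hC : MeasurableSet[𝓕.predictable.prod inferInstance] C) :
    AEMeasurable (fun ω => π k ω (markedSection C ω ∩ Iic t ×ˢ Iic m)) P ∧
      ∫⁻ ω, π k ω (markedSection C ω ∩ Iic t ×ˢ Iic m) ∂P =
        ∫⁻ ω, (lebesgueNNReal.prod lebesgueNNReal) (markedSection C ω ∩ Iic t ×ˢ Iic m) ∂P := by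
  set ν := lebesgueNNReal.prod lebesgueNNReal with hν
  have hDm : MeasurableSet (Iic t ×ˢ Iic m) := measurableSet_Iic.prod measurableSet_Iic
  have hνD : ν (Iic t ×ˢ Iic m) ≠ ∞ := by
    rw [hν, Measure.prod_prod, lebesgueNNReal_Iic, lebesgueNNReal_Iic]
    exact ENNReal.mul_ne_top ENNReal.coe_ne_top ENNReal.coe_ne_top
  have hπD := (h.poisson k).lintegral_apply hDm hνD
  have hπm : ∀ {B}, MeasurableSet B → Measurable fun ω => π k ω B := fun hB =>
    (Measure.measurable_coe hB).comp (h.poisson k).measurable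
  have hae : ∀ᵐ ω ∂P, π k ω (Iic t ×ˢ Iic m) < ∞ :=
    ae_lt_top (hπm hDm) (hπD.trans_ne hνD)
  refine @MeasurableSpace.induction_on_inter _ (𝓕.predictable.prod inferInstance) (fun C _ =>
    AEMeasurable (fun ω => π k ω (markedSection C ω ∩ Iic t ×ˢ Iic m)) P ∧
      ∫⁻ ω, π k ω (markedSection C ω ∩ Iic t ×ˢ Iic m) ∂P =
        ∫⁻ ω, ν (markedSection C ω ∩ Iic t ×ˢ Iic m) ∂P) _
    (@generateFrom_eq_prod _ _ 𝓕.predictable _ _ _ rfl MeasurableSpace.generateFrom_measurableSet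
      (isCountablySpanning_predictable 𝓕) isCountablySpanning_measurableSet).symm
    ((isPiSystem_predictable 𝓕).prod MeasurableSpace.isPiSystem_measurableSet) ?_ ?_ ?_ ?_ C hC
  · simp [markedSection]
  · rintro _ ⟨_, ⟨A, hA, rfl⟩ | ⟨i, A, hA, rfl⟩, B, hB, rfl⟩ <;> replace hB : MeasurableSet B := hB
    -- the generators `{0} × A` carry no points, as `{0}` is a null set of times
    · have hz : ν ({0} ×ˢ Iic m) = 0 := by rw [hν, Measure.prod_prod]; simp
      have hsub : ∀ ω, markedSection (({⊥} ×ˢ A) ×ˢ B) ω ∩ Iic t ×ˢ Iic m ⊆ {0} ×ˢ Iic m := by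
        rintro ω ⟨s, x⟩ ⟨⟨⟨h1, -⟩, -⟩, -, h2⟩
        exact ⟨h1, h2⟩
      have h0 : ∀ᵐ ω ∂P, π k ω ({0} ×ˢ Iic m) = 0 := by
        have hm0 : MeasurableSet (({0} : Set ℝ≥0) ×ˢ Iic m) :=
          (measurableSet_singleton _).prod measurableSet_Iic
        rw [← Filter.EventuallyEq.eq_1 (g := fun _ => (0 : ℝ≥0∞))]
        refine (lintegral_eq_zero_iff (hπm hm0)).1 ?_
        rw [(h.poisson k).lintegral_apply hm0 (by rw [← hν, hz]; simp), ← hν, hz]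
      have h1 : (fun ω => π k ω (markedSection (({⊥} ×ˢ A) ×ˢ B) ω ∩ Iic t ×ˢ Iic m))
          =ᵐ[P] fun _ => 0 := by
        filter_upwards [h0] with ω hω
        exact measure_mono_null (hsub ω) hω
      refine ⟨aemeasurable_const.congr h1.symm, ?_⟩
      rw [lintegral_congr_ae h1]
      simp only [fun ω => measure_mono_null (hsub ω) hz]
    · have key : ∀ (ρ : Measure (ℝ≥0 × ℝ≥0)) ω,
          ρ (markedSection ((Ioi i ×ˢ A) ×ˢ B) ω ∩ Iic t ×ˢ Iic m) =
            A.indicator 1 ω * ρ (Ioc i t ×ˢ (B ∩ Iic m)) := by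
        intro ρ ω
        by_cases hω : ω ∈ A
        · rw [indicator_of_mem hω, Pi.one_apply, one_mul]
          congr 1
          ext ⟨s, x⟩
          simp only [markedSection, mem_inter_iff, mem_ofPred_eq, mem_prod, mem_Ioi, mem_Iic,
            mem_Ioc]
          tauto
        · rw [indicator_of_notMem hω, zero_mul]
          convert measure_empty (μ := ρ)
          ext ⟨s, x⟩
          simp [markedSection, hω]
      have hBm : lebesgueNNReal (B ∩ Iic m) ≠ ∞ :=
        ne_top_of_le_ne_top (by rw [lebesgueNNReal_Iic]; exact ENNReal.coe_ne_top)
          (measure_mono inter_subset_right)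
      simp only [key]
      refine ⟨?_, h.lintegral_indicator_Ioc_prod k hA (hB.inter measurableSet_Iic) hBm⟩
      exact ((measurable_one.indicator (𝓕.le _ _ hA)).mul
        (hπm (measurableSet_Ioc.prod (hB.inter measurableSet_Iic)))).aemeasurable
  · rintro C hC ⟨h1, h2⟩
    have hCm := measurableSet_of_predictable_prod hC
    have key : ∀ (ρ : Measure (ℝ≥0 × ℝ≥0)) ω, ρ (Iic t ×ˢ Iic m) ≠ ∞ →
        ρ (markedSection Cᶜ ω ∩ Iic t ×ˢ Iic m) =
          ρ (Iic t ×ˢ Iic m) - ρ (markedSection C ω ∩ Iic t ×ˢ Iic m) := by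
      intro ρ ω hρ
      rw [← measure_sdiff inter_subset_right
        ((measurableSet_markedSection hCm ω).inter hDm).nullMeasurableSet
        (ne_top_of_le_ne_top hρ (measure_mono inter_subset_right))]
      congr 1
      ext q
      simp only [markedSection, mem_inter_iff, mem_ofPred_eq, mem_compl_iff, Set.mem_sdiff]
      tauto
    have h3 : (fun ω => π k ω (markedSection Cᶜ ω ∩ Iic t ×ˢ Iic m)) =ᵐ[P]
        fun ω => π k ω (Iic t ×ˢ Iic m) - π k ω (markedSection C ω ∩ Iic t ×ˢ Iic m) := by
      filter_upwards [hae] with ω hω using key _ ω hω.ne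
    have hle : ∫⁻ ω, ν (markedSection C ω ∩ Iic t ×ˢ Iic m) ∂P ≠ ∞ := by
      refine ne_top_of_le_ne_top hνD ((lintegral_mono fun ω =>
        measure_mono inter_subset_right).trans ?_)
      simp
    refine ⟨((hπm hDm).aemeasurable.sub h1).congr h3.symm, ?_⟩
    rw [lintegral_congr_ae h3, lintegral_sub' h1 (h2.trans_ne hle)
      (ae_of_all _ fun ω => measure_mono inter_subset_right), hπD, h2]
    simp only [fun ω => key ν ω hνD]
    rw [lintegral_sub' (measurable_lintegral_markedSection hCm _ hDm).aemeasurable hle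
      (ae_of_all _ fun ω => measure_mono inter_subset_right), lintegral_const, measure_univ,
      mul_one]
  · intro f hd hf h1
    have hfm := fun n => measurableSet_of_predictable_prod (hf n)
    have key : ∀ (ρ : Measure (ℝ≥0 × ℝ≥0)) ω,
        ρ (markedSection (⋃ n, f n) ω ∩ Iic t ×ˢ Iic m) =
          ∑' n, ρ (markedSection (f n) ω ∩ Iic t ×ˢ Iic m) := by
      intro ρ ω
      rw [← measure_iUnion]
      · congr 1
        ext q
        simp [markedSection]
      · intro n n' hn
        refine Disjoint.mono inter_subset_left inter_subset_left ?_
        exact disjoint_left.2 fun q hq hq' => disjoint_left.1 (hd hn) hq hq'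
      · exact fun n => (measurableSet_markedSection (hfm n) ω).inter hDm
    simp only [key]
    refine ⟨AEMeasurable.tsum fun n => (h1 n).1, ?_⟩
    rw [lintegral_tsum fun n => (h1 n).1, lintegral_tsum fun n =>
      (measurable_lintegral_markedSection (hfm n) _ hDm).aemeasurable]
    exact tsum_congr fun n => (h1 n).2

/-- The predictable intensity formula: for a predictable set of times and marks, the mean number
of points of the Poisson base is the mean intensity. -/
theorem IsPoissonBase.lintegral_markedSection {Ω ι : Type*} [mΩ : MeasurableSpace Ω]
    {P : Measure Ω} [IsProbabilityMeasure P]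
    {𝓕 : Filtration ℝ≥0 mΩ} {π : ι → Ω → Measure (ℝ≥0 × ℝ≥0)}
    (h : IsPoissonBase P 𝓕 π) (k : ι) (t : ℝ≥0) (C : Set ((ℝ≥0 × Ω) × ℝ≥0))
    (hC : MeasurableSet[𝓕.predictable.prod inferInstance] C) :
    ∫⁻ ω, π k ω (markedSection C ω ∩ Iic t ×ˢ univ) ∂P =
        ∫⁻ ω, (lebesgueNNReal.prod lebesgueNNReal) (markedSection C ω ∩ Iic t ×ˢ univ) ∂P := by
  have hmono : ∀ ω, Monotone fun n : ℕ => markedSection C ω ∩ Iic t ×ˢ Iic (n : ℝ≥0) := by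
    intro ω a b hab
    exact inter_subset_inter_right _ (prod_mono le_rfl (Iic_subset_Iic.2 (by exact_mod_cast hab)))
  have key : ∀ (ρ : Measure (ℝ≥0 × ℝ≥0)) ω, ρ (markedSection C ω ∩ Iic t ×ˢ univ) =
      ⨆ n : ℕ, ρ (markedSection C ω ∩ Iic t ×ˢ Iic (n : ℝ≥0)) := by
    intro ρ ω
    rw [← (hmono ω).measure_iUnion]
    congr 1
    ext ⟨s, x⟩
    obtain ⟨n, hn⟩ := exists_nat_ge x
    simp only [mem_inter_iff, mem_prod, mem_univ, and_true, mem_iUnion, mem_Iic]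
    exact ⟨fun hq => ⟨n, hq.1, hq.2, hn⟩, fun ⟨_, hq⟩ => ⟨hq.1, hq.2.1⟩⟩
  simp only [key]
  have hCm := measurableSet_of_predictable_prod hC
  rw [lintegral_iSup' (fun n => (h.lintegral_markedSection_box k t n C hC).1)
      (ae_of_all _ fun ω a b hab => measure_mono (hmono ω hab)),
    lintegral_iSup' (fun n => (measurable_lintegral_markedSection hCm _
      (measurableSet_Iic.prod measurableSet_Iic)).aemeasurable)
      (ae_of_all _ fun ω a b hab => measure_mono (hmono ω hab))]
  exact iSup_congr fun n => (h.lintegral_markedSection_box k t n C hC).2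

/-- The mean number of points of the base below a predictable process `L`, over a predictable set
of times `S`, is the mean integral of `L` over `S`. -/
theorem IsPoissonBase.lintegral_thinning {Ω ι : Type*} [mΩ : MeasurableSpace Ω]
    {P : Measure Ω} [IsProbabilityMeasure P]
    {𝓕 : Filtration ℝ≥0 mΩ} {π : ι → Ω → Measure (ℝ≥0 × ℝ≥0)}
    (h : IsPoissonBase P 𝓕 π) (k : ι) (t : ℝ≥0) {L : ℝ≥0 × Ω → ℝ≥0∞}
    (hL : Measurable[𝓕.predictable] L) {S : Set (ℝ≥0 × Ω)} (hS : MeasurableSet[𝓕.predictable] S) :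
    ∫⁻ ω, π k ω {q | q.1 ≤ t ∧ (q.1, ω) ∈ S ∧ (q.2 : ℝ≥0∞) ≤ L (q.1, ω)} ∂P =
      ∫⁻ ω, ∫⁻ s in Iic t, S.indicator L (s, ω) ∂lebesgueNNReal ∂P := by
  set C : Set ((ℝ≥0 × Ω) × ℝ≥0) := {x | x.1 ∈ S ∧ (x.2 : ℝ≥0∞) ≤ L x.1} with hCdef
  have hC : MeasurableSet[𝓕.predictable.prod inferInstance] C := by
    let _ : MeasurableSpace (ℝ≥0 × Ω) := 𝓕.predictable
    exact (measurable_fst hS).inter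
      (measurableSet_le (measurable_snd.coe_nnreal_ennreal) (hL.comp measurable_fst))
  have hset : ∀ ω, {q : ℝ≥0 × ℝ≥0 | q.1 ≤ t ∧ (q.1, ω) ∈ S ∧ (q.2 : ℝ≥0∞) ≤ L (q.1, ω)} =
      markedSection C ω ∩ Iic t ×ˢ univ := by
    intro ω
    ext q
    simp only [hCdef, markedSection, mem_inter_iff, mem_ofPred_eq, mem_prod, mem_Iic, mem_univ]
    tauto
  have hfib : ∀ a : ℝ≥0∞, lebesgueNNReal {x : ℝ≥0 | (x : ℝ≥0∞) ≤ a} = a := by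
    intro a
    induction a with
    | top =>
      have h1 : {x : ℝ≥0 | (x : ℝ≥0∞) ≤ ∞} = univ := by simp
      rw [h1, lebesgueNNReal_apply, image_univ, NNReal.range_coe, Real.volume_Ici]
    | coe a =>
      have h1 : {x : ℝ≥0 | (x : ℝ≥0∞) ≤ a} = Iic a := by ext; simp
      rw [h1, lebesgueNNReal_Iic]
  simp only [hset]
  rw [h.lintegral_markedSection k t C hC]
  refine lintegral_congr fun ω => ?_
  rw [Measure.prod_apply
    ((measurableSet_markedSection (measurableSet_of_predictable_prod hC) ω).inter
      (measurableSet_Iic.prod MeasurableSet.univ)), ← lintegral_indicator measurableSet_Iic]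
  refine lintegral_congr fun s => ?_
  by_cases hs : s ≤ t
  · rw [indicator_of_mem (by exact hs)]
    by_cases hsS : (s, ω) ∈ S
    · rw [indicator_of_mem hsS, ← hfib (L (s, ω))]
      congr 1
      ext x
      simp [markedSection, hCdef, hs, hsS]
    · rw [indicator_of_notMem hsS]
      convert measure_empty (μ := lebesgueNNReal)
      ext x
      simp [markedSection, hCdef, hsS]
  · rw [indicator_of_notMem (by exact hs)]
    convert measure_empty (μ := lebesgueNNReal)
    ext x
    simp [hs]

/-! ### Jump measures and the predictability of the intensity -/

/-- The time `min σ t`, as a finite time. -/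
def truncTime (t : ℝ≥0) (σ : WithTop ℝ≥0) : ℝ≥0 := WithTop.recTopCoe t (fun r => min r t) σ

@[simp] theorem truncTime_top (t : ℝ≥0) : truncTime t ⊤ = t := rfl

@[simp] theorem truncTime_coe (t r : ℝ≥0) : truncTime t r = min r t := rfl

theorem le_truncTime_iff {s t : ℝ≥0} {σ : WithTop ℝ≥0} :
    s ≤ truncTime t σ ↔ s ≤ t ∧ (s : WithTop ℝ≥0) ≤ σ := by
  induction σ with
  | top => exact ⟨fun h => ⟨h, le_top⟩, fun h => h.1⟩
  | coe r =>
    rw [truncTime_coe, le_min_iff, and_comm]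
    exact and_congr_right' WithTop.coe_le_coe.symm

theorem truncTime_le_iff {c t : ℝ≥0} {σ : WithTop ℝ≥0} :
    truncTime t σ ≤ c ↔ t ≤ c ∨ σ ≤ c := by
  induction σ with
  | top => exact ⟨Or.inl, fun h => h.resolve_right (WithTop.not_top_le_coe c)⟩
  | coe r =>
    rw [truncTime_coe, min_le_iff, or_comm]
    exact or_congr_right WithTop.coe_le_coe.symm

theorem truncTime_lt_iff {t : ℝ≥0} {σ : WithTop ℝ≥0} : truncTime t σ < t ↔ σ < t := by
  induction σ with
  | top => exact iff_of_false (lt_irrefl t) not_top_lt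
  | coe r =>
    rw [truncTime_coe, min_lt_iff]
    exact (or_iff_left (lt_irrefl t)).trans WithTop.coe_lt_coe.symm

theorem truncTime_le (t : ℝ≥0) (σ : WithTop ℝ≥0) : truncTime t σ ≤ t :=
  truncTime_le_iff.2 (Or.inl le_rfl)

theorem measurable_fst_predictable {Ω : Type*} [mΩ : MeasurableSpace Ω]
    (𝓕 : Filtration ℝ≥0 mΩ) : Measurable[𝓕.predictable] (Prod.fst : ℝ≥0 × Ω → ℝ≥0) := by
  refine @measurable_of_Iic _ _ _ _ _ 𝓕.predictable _ _ _ _ fun c => ?_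
  have h1 : (Prod.fst : ℝ≥0 × Ω → ℝ≥0) ⁻¹' Iic c = (Ioi c ×ˢ univ)ᶜ := by ext; simp
  rw [h1]
  exact (measurableSet_predictable_Ioi_prod (@MeasurableSet.univ _ (𝓕 c))).compl

/-- For a stopping time `σ`, the process `s ↦ min σ s` is predictable. -/
theorem MeasureTheory.IsStoppingTime.measurable_truncTime_predictable {Ω : Type*}
    [mΩ : MeasurableSpace Ω] {𝓕 : Filtration ℝ≥0 mΩ} {σ : Ω → WithTop ℝ≥0}
    (hσ : IsStoppingTime 𝓕 σ) :
    Measurable[𝓕.predictable] fun p : ℝ≥0 × Ω => truncTime p.1 (σ p.2) := by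
  refine @measurable_of_Iic _ _ _ _ _ 𝓕.predictable _ _ _ _ fun c => ?_
  have h1 : (fun p : ℝ≥0 × Ω => truncTime p.1 (σ p.2)) ⁻¹' Iic c =
      (Ioi c ×ˢ univ)ᶜ ∪ Ioi c ×ˢ {ω | σ ω ≤ c} := by
    ext p
    simp only [mem_preimage, mem_Iic, truncTime_le_iff, mem_union, mem_compl_iff, mem_prod, mem_Ioi,
      mem_univ, and_true, not_lt, mem_ofPred_eq]
    rcases le_or_gt p.1 c with h | h
    · simp [h]
    · simp [h]
  rw [h1]
  exact (measurableSet_predictable_Ioi_prod (@MeasurableSet.univ _ (𝓕 c))).compl.union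
    (measurableSet_predictable_Ioi_prod (hσ c))

theorem MeasureTheory.IsStoppingTime.measurableSet_le_predictable {Ω : Type*}
    [mΩ : MeasurableSpace Ω] {𝓕 : Filtration ℝ≥0 mΩ} {σ : Ω → WithTop ℝ≥0}
    (hσ : IsStoppingTime 𝓕 σ) :
    MeasurableSet[𝓕.predictable] {p : ℝ≥0 × Ω | (p.1 : WithTop ℝ≥0) ≤ σ p.2} := by
  have h1 : {p : ℝ≥0 × Ω | (p.1 : WithTop ℝ≥0) ≤ σ p.2} =
      {p : ℝ≥0 × Ω | p.1 ≤ truncTime p.1 (σ p.2)} := by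
    ext p
    simp [le_truncTime_iff]
  rw [h1]
  let _ : MeasurableSpace (ℝ≥0 × Ω) := 𝓕.predictable
  exact measurableSet_le (measurable_fst_predictable 𝓕) hσ.measurable_truncTime_predictable

theorem isStoppingTime_top {Ω : Type*} [mΩ : MeasurableSpace Ω] (𝓕 : Filtration ℝ≥0 mΩ) :
    IsStoppingTime 𝓕 fun _ => ⊤ := fun i => by simp

theorem lintegral_jumpMeasure (τ : ℕ → WithTop ℝ≥0) (f : ℝ≥0 → ℝ≥0∞) :
    ∫⁻ r, f r ∂jumpMeasure τ = ∑' n, WithTop.recTopCoe 0 f (τ n) := by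
  rw [jumpMeasure, lintegral_sum_measure]
  refine tsum_congr fun n => ?_
  induction τ n with
  | top => exact lintegral_zero_measure f
  | coe r => exact lintegral_dirac r f

theorem setLIntegral_jumpMeasure (τ : ℕ → WithTop ℝ≥0) {C : Set ℝ≥0} (hC : MeasurableSet C)
    (f : ℝ≥0 → ℝ≥0∞) :
    ∫⁻ r in C, f r ∂jumpMeasure τ = ∑' n, WithTop.recTopCoe 0 (C.indicator f) (τ n) := by
  rw [← lintegral_indicator hC, lintegral_jumpMeasure]

theorem jumpMeasure_apply (τ : ℕ → WithTop ℝ≥0) {C : Set ℝ≥0} (hC : MeasurableSet C) :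
    jumpMeasure τ C = ∑' n, WithTop.recTopCoe 0 (C.indicator 1) (τ n) := by
  rw [← lintegral_jumpMeasure, lintegral_indicator_one hC]

instance (τ : ℕ → WithTop ℝ≥0) : SFinite (jumpMeasure τ) := by
  have : ∀ n, SFinite (WithTop.recTopCoe (0 : Measure ℝ≥0)
      (fun t : ℝ≥0 => Measure.dirac t) (τ n)) := by
    intro n
    induction τ n with
    | top => exact inferInstanceAs (SFinite (0 : Measure ℝ≥0))
    | coe r => exact inferInstanceAs (SFinite (Measure.dirac r))
  unfold jumpMeasure
  infer_instance

theorem MeasureTheory.IsStoppingTime.measurable_recTopCoe {Ω : Type*} [mΩ : MeasurableSpace Ω]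
    {𝓕 : Filtration ℝ≥0 mΩ} {σ : Ω → WithTop ℝ≥0} (hσ : IsStoppingTime 𝓕 σ) {f : ℝ≥0 → ℝ≥0∞}
    (hf : Measurable f) : Measurable fun ω => (WithTop.recTopCoe 0 f (σ ω) : ℝ≥0∞) := by
  have hle : ∀ c : ℝ≥0, MeasurableSet {ω | σ ω ≤ c} := fun c => 𝓕.le c _ (hσ c)
  have htop : MeasurableSet {ω | σ ω = ⊤} := by
    have h1 : {ω | σ ω = ⊤} = (⋃ n : ℕ, {ω | σ ω ≤ (n : ℝ≥0)})ᶜ := by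
      ext ω
      simp only [mem_ofPred_eq, mem_compl_iff, mem_iUnion, not_exists]
      induction σ ω with
      | top => simp
      | coe r =>
        obtain ⟨n, hn⟩ := exists_nat_ge r
        simp only [WithTop.coe_ne_top, false_iff, not_forall, not_not]
        exact ⟨n, by exact_mod_cast hn⟩
    rw [h1]
    exact (MeasurableSet.iUnion fun n : ℕ => hle n).compl
  have hr : Measurable fun ω => (WithTop.recTopCoe 0 id (σ ω) : ℝ≥0) := by
    refine measurable_of_Iic fun c => ?_
    have h1 : (fun ω => (WithTop.recTopCoe 0 id (σ ω) : ℝ≥0)) ⁻¹' Iic c =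
        {ω | σ ω ≤ c} ∪ {ω | σ ω = ⊤} := by
      ext ω
      simp only [mem_preimage, mem_Iic, mem_union, mem_ofPred_eq]
      induction σ ω with
      | top => exact iff_of_true zero_le (Or.inr rfl)
      | coe r => exact WithTop.coe_le_coe.symm.trans (or_iff_left WithTop.coe_ne_top).symm
    rw [h1]
    exact (hle c).union htop
  have h2 : (fun ω => (WithTop.recTopCoe 0 f (σ ω) : ℝ≥0∞)) =
      {ω | σ ω = ⊤}ᶜ.indicator fun ω => f (WithTop.recTopCoe 0 id (σ ω)) := by
    ext ω
    by_cases h : σ ω = ⊤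
    · rw [indicator_of_notMem (by simpa using h), h]
      rfl
    · rw [indicator_of_mem (by simpa using h)]
      obtain ⟨r, hr⟩ := WithTop.ne_top_iff_exists.1 h
      rw [← hr]
      rfl
  rw [h2]
  exact (hf.comp hr).indicator htop.compl

theorem measurable_jumpMeasure {Ω : Type*} [mΩ : MeasurableSpace Ω]
    {𝓕 : Filtration ℝ≥0 mΩ} {τ : ℕ → Ω → WithTop ℝ≥0} (hτ : ∀ n, IsStoppingTime 𝓕 (τ n)) :
    Measurable fun ω => jumpMeasure fun n => τ n ω := by
  refine Measure.measurable_of_measurable_coe _ fun C hC => ?_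
  simp only [jumpMeasure_apply _ hC]
  exact Measurable.tsum fun n => (hτ n).measurable_recTopCoe (measurable_one.indicator hC)

/-- Integrals against the strict past of a point process whose jump times are stopping times are
predictable. -/
theorem measurable_predictable_setLIntegral_jumpMeasure {Ω : Type*} [mΩ : MeasurableSpace Ω]
    {𝓕 : Filtration ℝ≥0 mΩ} {τ : ℕ → Ω → WithTop ℝ≥0} (hτ : ∀ n, IsStoppingTime 𝓕 (τ n))
    {F : ℝ≥0 → ℝ≥0 → ℝ≥0∞} (hF : Measurable (Function.uncurry F)) :
    Measurable[𝓕.predictable] fun p : ℝ≥0 × Ω =>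
      ∫⁻ r in Ico 0 p.1, F p.1 r ∂jumpMeasure fun n => τ n p.2 := by
  -- below `s`, a jump time `τ` can be replaced by the predictable process `min τ s`
  have h1 : ∀ (p : ℝ≥0 × Ω) n, (WithTop.recTopCoe 0 ((Ico 0 p.1).indicator (F p.1)) (τ n p.2)
      : ℝ≥0∞) = {p : ℝ≥0 × Ω | truncTime p.1 (τ n p.2) < p.1}.indicator
        (fun p => F p.1 (truncTime p.1 (τ n p.2))) p := by
    intro p n
    by_cases h : truncTime p.1 (τ n p.2) < p.1
    · rw [indicator_of_mem (by exact h)]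
      rw [truncTime_lt_iff] at h
      obtain ⟨r, hr⟩ := WithTop.ne_top_iff_exists.1 h.ne_top
      rw [← hr] at h ⊢
      have h' : r < p.1 := by exact_mod_cast h
      rw [truncTime_coe, min_eq_left h'.le, WithTop.recTopCoe_coe, indicator_of_mem]
      exact ⟨zero_le, h'⟩
    · rw [indicator_of_notMem (by exact h)]
      rw [truncTime_lt_iff] at h
      induction hr : τ n p.2 with
      | top => rfl
      | coe r =>
        rw [hr] at h
        rw [WithTop.recTopCoe_coe, indicator_of_notMem]
        exact fun h' => h (by exact_mod_cast h'.2)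
  simp only [setLIntegral_jumpMeasure _ measurableSet_Ico, h1]
  let _ : MeasurableSpace (ℝ≥0 × Ω) := 𝓕.predictable
  refine Measurable.tsum fun n => ?_
  have h2 := (hτ n).measurable_truncTime_predictable
  have h3 := measurable_fst_predictable 𝓕
  exact (hF.comp (h3.prodMk h2)).indicator (measurableSet_lt h2 h3)

theorem measurable_predictable_hawkesIntensity {Ω ι : Type*} [mΩ : MeasurableSpace Ω] [Fintype ι]
    {𝓕 : Filtration ℝ≥0 mΩ} {τ : ι → ℕ → Ω → WithTop ℝ≥0}
    (hτ : ∀ k n, IsStoppingTime 𝓕 (τ k n)) (T : ℝ≥0) {μ : ι → ℝ → ℝ} {g : ℝ → ℝ}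
    {φ : ι → ι → ℝ → ℝ} (hμ : ∀ k, Measurable (μ k)) (hg : Measurable g)
    (hφ : ∀ k l, Measurable (φ k l)) (k : ι) :
    Measurable[𝓕.predictable] fun p : ℝ≥0 × Ω =>
      hawkesIntensity T μ g φ (fun l => jumpMeasure fun n => τ l n p.2) k p.1 := by
  have h3 := measurable_fst_predictable 𝓕
  have h4 : ∀ l, Measurable[𝓕.predictable] fun p : ℝ≥0 × Ω =>
      ∫⁻ s in Ico 0 p.1, ENNReal.ofReal (g (p.1 / T) * φ k l ((p.1 : ℝ) - s))
        ∂jumpMeasure fun n => τ l n p.2 := by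
    intro l
    refine measurable_predictable_setLIntegral_jumpMeasure (hτ l)
      (F := fun t s : ℝ≥0 => ENNReal.ofReal (g (t / T) * φ k l ((t : ℝ) - s))) ?_
    have := hφ k l
    simp only [Function.uncurry_def]
    fun_prop
  unfold hawkesIntensity
  let _ : MeasurableSpace (ℝ≥0 × Ω) := 𝓕.predictable
  refine Measurable.add ?_ (Finset.measurable_sum _ fun l _ => h4 l)
  have h5 : Measurable fun t : ℝ≥0 => ENNReal.ofReal (μ k (t / T)) := by
    have := hμ k
    fun_prop
  exact h5.comp h3

/-- Dynkin-type formula: the mean number of jumps up to a bounded stopping time is the mean of the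
intensity integrated up to that time. -/
theorem lintegral_jumpMeasure_truncTime {Ω ι : Type*} [mΩ : MeasurableSpace Ω] [Fintype ι]
    {P : Measure Ω} [IsProbabilityMeasure P]
    {𝓕 : Filtration ℝ≥0 mΩ} {π : ι → Ω → Measure (ℝ≥0 × ℝ≥0)} (hπ : IsPoissonBase P 𝓕 π)
    {τ : ι → ℕ → Ω → WithTop ℝ≥0}
    (hτ : ∀ k n, IsStoppingTime 𝓕 (τ k n)) {T : ℝ≥0} {μ : ι → ℝ → ℝ} {g : ℝ → ℝ}
    {φ : ι → ι → ℝ → ℝ} (hμ : ∀ k, Measurable (μ k)) (hg : Measurable g)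
    (hφ : ∀ k l, Measurable (φ k l))
    (hN : ∀ᵐ ω ∂P, ∀ k, ∀ t ≤ T, jumpMeasure (fun n => τ k n ω) (Icc 0 t) =
        π k ω {q : ℝ≥0 × ℝ≥0 | q.1 ≤ t ∧ (q.2 : ℝ≥0∞) ≤
          hawkesIntensity T μ g φ (fun l => jumpMeasure (fun n => τ l n ω)) k q.1})
    (k : ι) {t : ℝ≥0} (ht : t ≤ T) {σ : Ω → WithTop ℝ≥0} (hσ : IsStoppingTime 𝓕 σ) :
    ∫⁻ ω, jumpMeasure (fun n => τ k n ω) (Icc 0 (truncTime t (σ ω))) ∂P =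
      ∫⁻ ω, ∫⁻ s in Icc 0 (truncTime t (σ ω)),
        hawkesIntensity T μ g φ (fun l => jumpMeasure (fun n => τ l n ω)) k s
          ∂lebesgueNNReal ∂P := by
  have h1 := hπ.lintegral_thinning k t
    (measurable_predictable_hawkesIntensity hτ T hμ hg hφ k) hσ.measurableSet_le_predictable
  have h2 : (fun ω => jumpMeasure (fun n => τ k n ω) (Icc 0 (truncTime t (σ ω)))) =ᵐ[P] fun ω =>
      π k ω {q | q.1 ≤ t ∧ (q.1, ω) ∈ {p : ℝ≥0 × Ω | (p.1 : WithTop ℝ≥0) ≤ σ p.2} ∧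
        (q.2 : ℝ≥0∞) ≤
          hawkesIntensity T μ g φ (fun l => jumpMeasure (fun n => τ l n ω)) k q.1} := by
    filter_upwards [hN] with ω hω
    rw [hω k _ ((truncTime_le _ _).trans ht)]
    simp only [le_truncTime_iff, and_assoc]
  rw [lintegral_congr_ae h2, h1]
  refine lintegral_congr fun ω => ?_
  rw [← lintegral_indicator measurableSet_Iic, ← lintegral_indicator measurableSet_Icc]
  refine lintegral_congr fun s => ?_
  by_cases h3 : s ≤ t
  · rw [indicator_of_mem (by exact h3)]
    by_cases h4 : (s : WithTop ℝ≥0) ≤ σ ω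
    · rw [indicator_of_mem (by exact h4), indicator_of_mem]
      exact ⟨zero_le, le_truncTime_iff.2 ⟨h3, h4⟩⟩
    · rw [indicator_of_notMem (by exact h4), indicator_of_notMem]
      exact fun h => h4 (le_truncTime_iff.1 h.2).2
  · rw [indicator_of_notMem (by exact h3), indicator_of_notMem]
    exact fun h => h3 (le_truncTime_iff.1 h.2).1

/-! ### Non-explosion and finiteness of the mean number of jumps -/

theorem IsJumpSequence.lt_or_eq_top {τ : ℕ → WithTop ℝ≥0} (h : IsJumpSequence τ) {n m : ℕ}
    (hnm : n < m) : τ n < τ m ∨ τ m = ⊤ := by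
  induction m, hnm using Nat.le_induction with
  | base => exact (h.2 n).imp_right And.right
  | succ m _ ih =>
    rcases h.2 m with h1 | h1
    · rcases ih with h2 | h2
      · exact Or.inl (h2.trans h1)
      · exact absurd h1 (by rw [h2]; exact not_top_lt)
    · exact Or.inr h1.2

theorem IsJumpSequence.monotone {τ : ℕ → WithTop ℝ≥0} (h : IsJumpSequence τ) : Monotone τ := by
  refine monotone_nat_of_le_succ fun n => ?_
  rcases h.2 n with h1 | h1
  · exact h1.le
  · rw [h1.2]
    exact le_top

theorem recTopCoe_indicator_Icc (c : ℝ≥0) (σ : WithTop ℝ≥0) :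
    (WithTop.recTopCoe 0 ((Icc 0 c).indicator 1) σ : ℝ≥0∞) =
      {σ : WithTop ℝ≥0 | σ ≤ c}.indicator 1 σ := by
  induction σ with
  | top => exact (indicator_of_notMem (WithTop.not_top_le_coe c) _).symm
  | coe r =>
    rw [WithTop.recTopCoe_coe]
    by_cases h : r ≤ c
    · rw [indicator_of_mem (show r ∈ Icc 0 c from ⟨zero_le, h⟩),
        indicator_of_mem (by exact WithTop.coe_le_coe.2 h)]
      rfl
    · rw [indicator_of_notMem (show r ∉ Icc 0 c from fun h' => h h'.2),
        indicator_of_notMem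
        (show (r : WithTop ℝ≥0) ∉ {σ : WithTop ℝ≥0 | σ ≤ c} from
          fun h' => h (WithTop.coe_le_coe.1 h'))]

theorem jumpMeasure_Icc (τ : ℕ → WithTop ℝ≥0) (c : ℝ≥0) :
    jumpMeasure τ (Icc 0 c) = ∑' n, {σ : WithTop ℝ≥0 | σ ≤ c}.indicator 1 (τ n) := by
  rw [jumpMeasure_apply _ measurableSet_Icc]
  exact tsum_congr fun n => recTopCoe_indicator_Icc c (τ n)

theorem IsJumpSequence.jumpMeasure_Icc_zero {τ : ℕ → WithTop ℝ≥0} (h : IsJumpSequence τ) :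
    jumpMeasure τ (Icc 0 0) = 0 := by
  rw [jumpMeasure_Icc]
  refine ENNReal.tsum_eq_zero.2 fun n => indicator_of_notMem (fun h' => ?_) _
  exact absurd (h.1.trans_le (h.monotone (Nat.zero_le n))) (not_lt.2 h')

theorem IsJumpSequence.jumpMeasure_Icc_le {τ : ℕ → WithTop ℝ≥0} (h : IsJumpSequence τ) {n : ℕ}
    {c : ℝ≥0} (hc : (c : WithTop ℝ≥0) ≤ τ n) : jumpMeasure τ (Icc 0 c) ≤ n + 1 := by
  rw [jumpMeasure_Icc, tsum_eq_sum (s := Finset.range (n + 1))]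
  · refine (Finset.sum_le_card_nsmul _ _ 1 fun m _ => ?_).trans ?_
    · exact indicator_le_self' (fun _ _ => zero_le) _
    · simp
  · intro m hm
    have hnm : n < m := by simpa using hm
    refine indicator_of_notMem (fun h' => ?_) _
    rcases h.lt_or_eq_top hnm with h1 | h1
    · exact absurd (hc.trans_lt h1) (not_lt.2 h')
    · rw [h1] at h'
      exact WithTop.not_top_le_coe c h'

theorem IsJumpSequence.le_jumpMeasure_Icc {τ : ℕ → WithTop ℝ≥0} (h : IsJumpSequence τ) {n : ℕ}
    {c : ℝ≥0} (hc : τ n ≤ c) : (n + 1 : ℝ≥0∞) ≤ jumpMeasure τ (Icc 0 c) := by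
  rw [jumpMeasure_Icc]
  refine le_trans ?_ (ENNReal.sum_le_tsum (Finset.range (n + 1)))
  rw [Finset.sum_congr rfl fun m hm => indicator_of_mem (s := {σ : WithTop ℝ≥0 | σ ≤ c})
    (f := 1) ((h.monotone (Nat.lt_succ_iff.1 (Finset.mem_range.1 hm))).trans hc)]
  simp

theorem MeasureTheory.IsStoppingTime.measurable_truncTime {Ω : Type*} [mΩ : MeasurableSpace Ω]
    {𝓕 : Filtration ℝ≥0 mΩ} {σ : Ω → WithTop ℝ≥0} (hσ : IsStoppingTime 𝓕 σ) (t : ℝ≥0) :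
    Measurable fun ω => truncTime t (σ ω) :=
  (hσ.measurable_truncTime_predictable.mono (predictable_le_prod 𝓕) le_rfl).comp
    (measurable_prodMk_left (x := t))

theorem measurable_jumpMeasure_truncTime {Ω : Type*} [mΩ : MeasurableSpace Ω]
    {𝓕 : Filtration ℝ≥0 mΩ} {τ : ℕ → Ω → WithTop ℝ≥0} (hτ : ∀ n, IsStoppingTime 𝓕 (τ n))
    (t : ℝ≥0) {σ : Ω → WithTop ℝ≥0} (hσ : IsStoppingTime 𝓕 σ) :
    Measurable fun ω => jumpMeasure (fun n => τ n ω) (Icc 0 (truncTime t (σ ω))) := by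
  simp only [jumpMeasure_Icc]
  refine Measurable.tsum fun n => ?_
  have h1 : (fun ω => ({s : WithTop ℝ≥0 | s ≤ truncTime t (σ ω)}.indicator 1 (τ n ω) : ℝ≥0∞)) =
      ({ω | τ n ω ≤ t} ∩ {ω | truncTime t (τ n ω) ≤ truncTime t (σ ω)}).indicator 1 := by
    ext ω
    simp only [indicator_apply, Pi.one_apply, mem_inter_iff, mem_ofPred_eq]
    congr 1
    refine propext ⟨fun h => ⟨h.trans (WithTop.coe_le_coe.2 (truncTime_le _ _)),
      truncTime_le_iff.2 (Or.inr h)⟩, fun ⟨h, h'⟩ => ?_⟩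
    rcases truncTime_le_iff.1 h' with h2 | h2
    · exact h.trans (WithTop.coe_le_coe.2 h2)
    · exact h2
  rw [h1]
  exact measurable_one.indicator ((𝓕.le t _ (hτ n t)).inter
    (measurableSet_le ((hτ n).measurable_truncTime t) (hσ.measurable_truncTime t)))

/-- The exponential kernel has total mass at most `1`. -/
theorem lintegral_expKernel_le_one {β : ℝ} (hβ : 0 < β) (r : ℝ≥0) :
    ∫⁻ s in Ioi r, ENNReal.ofReal (β * Real.exp (-β * ((s : ℝ) - r))) ∂lebesgueNNReal ≤ 1 := by
  have h1 : ∫⁻ s in Ioi r, ENNReal.ofReal (β * Real.exp (-β * ((s : ℝ) - r))) ∂lebesgueNNReal =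
      ∫⁻ x in Ioi (r : ℝ), ENNReal.ofReal (β * Real.exp (-β * (x - r)))
        ∂(lebesgueNNReal.map ((↑) : ℝ≥0 → ℝ)) := by
    rw [setLIntegral_map measurableSet_Ioi (by fun_prop) NNReal.measurableEmbedding_coe.measurable]
    rfl
  have h2 : ∀ x : ℝ, β * Real.exp (-β * (x - r)) =
      (β * Real.exp (β * r)) * Real.exp (-β * x) := by
    intro x
    rw [mul_assoc, ← Real.exp_add]
    ring_nf
  have h3 : IntegrableOn (fun x : ℝ => β * Real.exp (-β * (x - r))) (Ioi (r : ℝ)) := by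
    simp only [h2]
    exact (integrableOn_exp_mul_Ioi (by linarith) _).const_mul _
  rw [h1, map_coe_lebesgueNNReal]
  refine (lintegral_mono' (Measure.restrict_mono le_rfl Measure.restrict_le_self) le_rfl).trans ?_
  rw [← ofReal_integral_eq_lintegral_ofReal h3 (ae_of_all _ fun x => by positivity)]
  simp only [h2]
  rw [integral_const_mul, integral_exp_mul_Ioi (by linarith)]
  rw [show β * Real.exp (β * r) * (-Real.exp (-β * r) / -β) =
    Real.exp (β * r) * Real.exp (-β * r) by field_simp, ← Real.exp_add]
  simp

/-- Pathwise, the self-exciting part of the intensity integrates to at most `α₀` times the number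
of past jumps: each jump triggers at most `α₀` further ones on average. -/
theorem lintegral_excitation_le {β α₀ : ℝ} (hβ : 0 < β) {g : ℝ≥0 → ℝ} (hg : ∀ s, g s ≤ α₀)
    (N : Measure ℝ≥0) [SFinite N] (c : ℝ≥0) :
    ∫⁻ s in Icc 0 c, ∫⁻ r in Ico 0 s, ENNReal.ofReal (g s * (β * Real.exp (-β * ((s : ℝ) - r))))
      ∂N ∂lebesgueNNReal ≤ ENNReal.ofReal α₀ * N (Icc 0 c) := by
  -- Tonelli: integrate first over the later time `s`, for a fixed jump time `r < s`
  set F : ℝ≥0 → ℝ≥0 → ℝ≥0∞ := fun s r => (Ioi r).indicator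
    (fun s => ENNReal.ofReal (β * Real.exp (-β * ((s : ℝ) - r)))) s with hF
  have hFm : Measurable (Function.uncurry F) := by
    have h1 : Function.uncurry F = {p : ℝ≥0 × ℝ≥0 | p.2 < p.1}.indicator
        (fun p => ENNReal.ofReal (β * Real.exp (-β * ((p.1 : ℝ) - p.2)))) := by
      ext p
      simp only [hF, Function.uncurry, indicator_apply, mem_Ioi, mem_ofPred_eq]
    rw [h1]
    exact Measurable.indicator (by fun_prop) (measurableSet_lt measurable_snd measurable_fst)
  calc ∫⁻ s in Icc 0 c, ∫⁻ r in Ico 0 s,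
        ENNReal.ofReal (g s * (β * Real.exp (-β * ((s : ℝ) - r)))) ∂N ∂lebesgueNNReal
      ≤ ∫⁻ s in Icc 0 c, ∫⁻ r in Icc 0 c, ENNReal.ofReal α₀ * F s r ∂N ∂lebesgueNNReal := by
        refine setLIntegral_mono' measurableSet_Icc fun s hs => ?_
        rw [← lintegral_indicator measurableSet_Ico, ← lintegral_indicator measurableSet_Icc]
        refine lintegral_mono fun r => ?_
        by_cases hr : r < s
        · rw [indicator_of_mem (show r ∈ Ico 0 s from ⟨zero_le, hr⟩),
            indicator_of_mem (show r ∈ Icc 0 c from ⟨zero_le, hr.le.trans hs.2⟩), hF]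
          simp only
          rw [indicator_of_mem (by exact hr), ← ENNReal.ofReal_mul' (by positivity)]
          exact ENNReal.ofReal_le_ofReal (mul_le_mul_of_nonneg_right (hg s) (by positivity))
        · rw [indicator_of_notMem (show r ∉ Ico 0 s from fun h => hr h.2)]
          exact zero_le
    _ = ∫⁻ r in Icc 0 c, ∫⁻ s in Icc 0 c, ENNReal.ofReal α₀ * F s r ∂lebesgueNNReal ∂N :=
        lintegral_lintegral_swap (hFm.const_mul _).aemeasurable
    _ ≤ ∫⁻ r in Icc 0 c, ENNReal.ofReal α₀ ∂N := by
        refine lintegral_mono fun r => ?_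
        have hFr : Measurable fun s => F s r := hFm.comp (measurable_prodMk_right (y := r))
        rw [lintegral_const_mul _ hFr]
        refine mul_le_of_le_one_right' ?_
        refine (setLIntegral_le_lintegral _ _).trans ?_
        rw [lintegral_indicator measurableSet_Ioi]
        exact lintegral_expKernel_le_one hβ r
    _ = ENNReal.ofReal α₀ * N (Icc 0 c) := setLIntegral_const _ _

theorem quadraticRate_le {α₀ η : ℝ} (hα₀ : 0 ≤ α₀) (hη : 0 ≤ η) (x : ℝ) :
    quadraticRate α₀ η x ≤ α₀ := by
  unfold quadraticRate
  nlinarith [mul_nonneg hα₀ (mul_nonneg hη (sq_nonneg x))]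

theorem quadraticRate_nonneg {α₀ η x : ℝ} (hα₀ : 0 ≤ α₀) (hη' : η ≤ 1) (hx : 0 ≤ x)
    (hx' : x ≤ 1) : 0 ≤ quadraticRate α₀ η x := by
  have h1 : x ^ 2 ≤ 1 := pow_le_one₀ hx hx'
  exact mul_nonneg hα₀ (sub_nonneg.2 (mul_le_one₀ hη' (sq_nonneg x) h1))

theorem measurable_directionalBaseline (μ₀ Δμ : ℝ) (k : Fin 2) :
    Measurable (directionalBaseline μ₀ Δμ k) := measurable_const

theorem measurable_quadraticRate (α₀ η : ℝ) : Measurable (quadraticRate α₀ η) := by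
  unfold quadraticRate
  fun_prop

theorem measurable_antidiagExpKernel (β : ℝ) (k l : Fin 2) :
    Measurable (antidiagExpKernel β k l) := by
  unfold antidiagExpKernel
  split_ifs <;> fun_prop

theorem hawkesIntensity_directional (T : ℝ≥0) (μ₀ Δμ β : ℝ) (g : ℝ → ℝ)
    (N : Fin 2 → Measure ℝ≥0) (k : Fin 2) (t : ℝ≥0) :
    hawkesIntensity T (directionalBaseline μ₀ Δμ) g (antidiagExpKernel β) N k t =
      ENNReal.ofReal (directionalBaseline μ₀ Δμ k 0) + ∫⁻ s in Ico 0 t,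
        ENNReal.ofReal (g (t / T) * (β * Real.exp (-β * ((t : ℝ) - s)))) ∂N (1 - k) := by
  fin_cases k <;> simp [hawkesIntensity, antidiagExpKernel, directionalBaseline]

/-- Up to a stopping time, the mean number of jumps of one coordinate is at most its mean number of
exogenous jumps plus `α₀` times the mean number of jumps of the other coordinate. -/
theorem lintegral_jumpMeasure_truncTime_le {Ω : Type*} [mΩ : MeasurableSpace Ω]
    {P : Measure Ω} [IsProbabilityMeasure P]
    {𝓕 : Filtration ℝ≥0 mΩ} {π : Fin 2 → Ω → Measure (ℝ≥0 × ℝ≥0)} (hπ : IsPoissonBase P 𝓕 π)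
    {τ : Fin 2 → ℕ → Ω → WithTop ℝ≥0} (hτ : ∀ k n, IsStoppingTime 𝓕 (τ k n)) {T : ℝ≥0}
    {μ₀ Δμ α₀ η β : ℝ} (hα₀ : 0 ≤ α₀) (hη : 0 ≤ η) (hβ : 0 < β)
    (hN : ∀ᵐ ω ∂P, ∀ k, ∀ t ≤ T, jumpMeasure (fun n => τ k n ω) (Icc 0 t) =
        π k ω {q : ℝ≥0 × ℝ≥0 | q.1 ≤ t ∧ (q.2 : ℝ≥0∞) ≤
          hawkesIntensity T (directionalBaseline μ₀ Δμ) (quadraticRate α₀ η)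
            (antidiagExpKernel β) (fun l => jumpMeasure (fun n => τ l n ω)) k q.1})
    (k : Fin 2) {t : ℝ≥0} (ht : t ≤ T) {σ : Ω → WithTop ℝ≥0} (hσ : IsStoppingTime 𝓕 σ) :
    ∫⁻ ω, jumpMeasure (fun n => τ k n ω) (Icc 0 (truncTime t (σ ω))) ∂P ≤
      ENNReal.ofReal (directionalBaseline μ₀ Δμ k 0) * t + ENNReal.ofReal α₀ *
        ∫⁻ ω, jumpMeasure (fun n => τ (1 - k) n ω) (Icc 0 (truncTime t (σ ω))) ∂P := by
  rw [lintegral_jumpMeasure_truncTime hπ hτ (measurable_directionalBaseline μ₀ Δμ)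
    (measurable_quadraticRate α₀ η) (measurable_antidiagExpKernel β) hN k ht hσ,
    ← lintegral_const_mul' _ _ ENNReal.ofReal_ne_top]
  refine (lintegral_mono (g := fun ω => ENNReal.ofReal (directionalBaseline μ₀ Δμ k 0) * t +
    ENNReal.ofReal α₀ * jumpMeasure (fun n => τ (1 - k) n ω) (Icc 0 (truncTime t (σ ω))))
      fun ω => ?_).trans ?_
  · simp only [hawkesIntensity_directional]
    rw [lintegral_add_left measurable_const, setLIntegral_const]
    gcongr
    · rw [lebesgueNNReal_Icc]
      exact_mod_cast truncTime_le _ _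
    · exact lintegral_excitation_le hβ (g := fun s => quadraticRate α₀ η (s / T))
        (fun s => quadraticRate_le hα₀ hη _) _ _
  · rw [lintegral_add_left measurable_const, lintegral_const, measure_univ, mul_one]

/-- Subcriticality `α₀ < 1` bounds the mean number of jumps before a localising time, with a bound
that does not depend on that time. -/
theorem lintegral_jumpMeasure_truncTime_add_le {Ω : Type*} [mΩ : MeasurableSpace Ω]
    {P : Measure Ω} [IsProbabilityMeasure P]
    {𝓕 : Filtration ℝ≥0 mΩ} {π : Fin 2 → Ω → Measure (ℝ≥0 × ℝ≥0)} (hπ : IsPoissonBase P 𝓕 π)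
    {τ : Fin 2 → ℕ → Ω → WithTop ℝ≥0} (hτ : ∀ k n, IsStoppingTime 𝓕 (τ k n)) {T : ℝ≥0}
    {μ₀ Δμ α₀ η β : ℝ} (hα₀ : 0 ≤ α₀) (hα₀' : α₀ < 1) (hη : 0 ≤ η) (hβ : 0 < β)
    (hN : ∀ᵐ ω ∂P, ∀ k, ∀ t ≤ T, jumpMeasure (fun n => τ k n ω) (Icc 0 t) =
        π k ω {q : ℝ≥0 × ℝ≥0 | q.1 ≤ t ∧ (q.2 : ℝ≥0∞) ≤
          hawkesIntensity T (directionalBaseline μ₀ Δμ) (quadraticRate α₀ η)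
            (antidiagExpKernel β) (fun l => jumpMeasure (fun n => τ l n ω)) k q.1})
    {t : ℝ≥0} (ht : t ≤ T) {σ : Ω → WithTop ℝ≥0} (hσ : IsStoppingTime 𝓕 σ)
    (hfin : ∀ k, ∫⁻ ω, jumpMeasure (fun n => τ k n ω) (Icc 0 (truncTime t (σ ω))) ∂P ≠ ∞) :
    ∫⁻ ω, jumpMeasure (fun n => τ 0 n ω) (Icc 0 (truncTime t (σ ω))) ∂P +
      ∫⁻ ω, jumpMeasure (fun n => τ 1 n ω) (Icc 0 (truncTime t (σ ω))) ∂P ≤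
      (ENNReal.ofReal (directionalBaseline μ₀ Δμ 0 0) * t +
        ENNReal.ofReal (directionalBaseline μ₀ Δμ 1 0) * t) / ENNReal.ofReal (1 - α₀) := by
  have h0 := lintegral_jumpMeasure_truncTime_le hπ hτ hα₀ hη hβ hN 0 ht hσ
  have h1 := lintegral_jumpMeasure_truncTime_le hπ hτ hα₀ hη hβ hN 1 ht hσ
  rw [sub_zero] at h0
  rw [sub_self] at h1
  have hfin0 := hfin 0
  have hfin1 := hfin 1
  generalize ∫⁻ ω, jumpMeasure (fun n => τ 0 n ω) (Icc 0 (truncTime t (σ ω))) ∂P = a at *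
  generalize ∫⁻ ω, jumpMeasure (fun n => τ 1 n ω) (Icc 0 (truncTime t (σ ω))) ∂P = b at *
  generalize ENNReal.ofReal (directionalBaseline μ₀ Δμ 0 0) * t = x at *
  generalize ENNReal.ofReal (directionalBaseline μ₀ Δμ 1 0) * t = y at *
  rw [ENNReal.le_div_iff_mul_le (Or.inl (by simpa using hα₀')) (Or.inl ENNReal.ofReal_ne_top)]
  have hab : a + b ≠ ∞ := ENNReal.add_ne_top.2 ⟨hfin0, hfin1⟩
  have hle : a + b ≤ x + y + ENNReal.ofReal α₀ * (a + b) := by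
    refine (add_le_add h0 h1).trans (le_of_eq ?_)
    ring
  have hone : ENNReal.ofReal (1 - α₀) + ENNReal.ofReal α₀ = 1 := by
    rw [← ENNReal.ofReal_add (by linarith) hα₀]
    simp
  refine (ENNReal.add_le_add_iff_right (ENNReal.mul_ne_top ENNReal.ofReal_ne_top hab)).1
    (le_trans (le_of_eq ?_) hle)
  rw [mul_comm (a + b), ← add_mul, hone, one_mul]

/-- The mean numbers of jumps up to the horizon are finite; in particular the price model does not
explode. -/
theorem IsHawkesPriceModel.lintegral_countUpTo_lt_top {Ω : Type*} [mΩ : MeasurableSpace Ω]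
    {P : Measure Ω} [IsProbabilityMeasure P] {T : ℝ≥0} {μ₀ Δμ α₀ η β : ℝ}
    {τ : Fin 2 → ℕ → Ω → WithTop ℝ≥0} (h : IsHawkesPriceModel P T μ₀ Δμ α₀ η β τ)
    (hα₀ : 0 ≤ α₀) (hα₀' : α₀ < 1) (hη : 0 ≤ η) (hβ : 0 < β) {t : ℝ≥0} (ht : t ≤ T)
    (k : Fin 2) : ∫⁻ ω, countUpTo τ k t ω ∂P < ∞ := by
  obtain ⟨𝓕, π, hπ, hτ, hjump, hN⟩ := h
  -- before `σ n` each coordinate has at most `n + 1` jumps, and by `σ n` some coordinate has them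
  set σ : ℕ → Ω → WithTop ℝ≥0 := fun n ω => min (τ 0 n ω) (τ 1 n ω) with hσdef
  have hσ : ∀ n, IsStoppingTime 𝓕 (σ n) := fun n => (hτ 0 n).min (hτ 1 n)
  have hσle : ∀ k n ω, σ n ω ≤ τ k n ω := by
    intro k n ω
    fin_cases k
    · exact min_le_left _ _
    · exact min_le_right _ _
  set K : ℝ≥0∞ := (ENNReal.ofReal (directionalBaseline μ₀ Δμ 0 0) * t +
        ENNReal.ofReal (directionalBaseline μ₀ Δμ 1 0) * t) / ENNReal.ofReal (1 - α₀) with hK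
  have hKtop : K < ∞ := by
    refine ENNReal.div_lt_top ?_ (by simpa using hα₀')
    exact ENNReal.add_ne_top.2 ⟨ENNReal.mul_ne_top ENNReal.ofReal_ne_top ENNReal.coe_ne_top,
      ENNReal.mul_ne_top ENNReal.ofReal_ne_top ENNReal.coe_ne_top⟩
  have hmeas := fun k n => measurable_jumpMeasure_truncTime (hτ k) t (hσ n)
  have hfin : ∀ n k,
      ∫⁻ ω, jumpMeasure (fun n => τ k n ω) (Icc 0 (truncTime t (σ n ω))) ∂P ≠ ∞ := by
    intro n k
    refine ne_top_of_le_ne_top (b := (n + 1 : ℝ≥0∞)) (by finiteness) ?_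
    refine (lintegral_mono_ae (g := fun _ => (n + 1 : ℝ≥0∞)) ?_).trans (by simp)
    filter_upwards [hjump] with ω hω
    exact (hω k).jumpMeasure_Icc_le ((le_truncTime_iff.1 le_rfl).2.trans (hσle k n ω))
  have hbound := fun n => lintegral_jumpMeasure_truncTime_add_le hπ hτ hα₀ hα₀' hη hβ hN ht
    (hσ n) (hfin n)
  -- an explosion before `t` would make the numbers of jumps up to `σ n` at least `n + 1`, against
  -- the bound `K`, which does not depend on `n`
  have hex : ∀ᵐ ω ∂P, ∃ n, ¬ σ n ω ≤ t := by
    have hle : ∀ n : ℕ, (n + 1 : ℝ≥0∞) * P {ω | ∀ n, σ n ω ≤ t} ≤ K := by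
      intro n
      refine le_trans ?_ (hbound n)
      rw [← lintegral_add_left (hmeas 0 n)]
      refine le_trans (mul_le_mul_right ?_ _) (mul_meas_ge_le_lintegral
        ((hmeas 0 n).add (hmeas 1 n)) (n + 1 : ℝ≥0∞))
      refine measure_mono_ae ?_
      filter_upwards [hjump] with ω hω hω'
      have h1 : σ n ω ≤ truncTime t (σ n ω) := by
        have := hω' n
        obtain ⟨r, hr⟩ := WithTop.ne_top_iff_exists.1 (ne_top_of_le_ne_top WithTop.coe_ne_top this)
        rw [← hr] at this ⊢
        rw [truncTime_coe]
        exact WithTop.coe_le_coe.2 (le_min le_rfl (WithTop.coe_le_coe.1 this))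
      rcases min_choice (τ 0 n ω) (τ 1 n ω) with h2 | h2
      · refine le_add_right ((hω 0).le_jumpMeasure_Icc ?_)
        rw [← h2]
        exact h1
      · refine le_add_left ((hω 1).le_jumpMeasure_Icc ?_)
        rw [← h2]
        exact h1
    have h0 : P {ω | ∀ n, σ n ω ≤ t} = 0 := by
      by_contra hne
      obtain ⟨n, hn⟩ := ENNReal.exists_nat_mul_gt hne hKtop.ne
      refine absurd (hle n) (not_le.2 (hn.trans_le ?_))
      gcongr
      exact le_self_add
    refine (ae_iff.2 ?_)
    simpa only [not_exists, not_not] using h0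
  -- almost surely `σ n` exceeds `t` eventually, and Fatou's lemma transfers the bound to time `t`
  have hliminf : ∀ᵐ ω ∂P, countUpTo τ k t ω ≤
      liminf (fun n => jumpMeasure (fun n => τ k n ω) (Icc 0 (truncTime t (σ n ω)))) atTop := by
    filter_upwards [hex, hjump] with ω ⟨n, hn⟩ hω
    refine le_liminf_of_le (by isBoundedDefault) ?_
    filter_upwards [eventually_ge_atTop n] with m hm
    have h1 : t ≤ truncTime t (σ m ω) := by
      refine le_truncTime_iff.2 ⟨le_rfl, (not_le.1 hn).le.trans ?_⟩
      exact min_le_min ((hω 0).monotone hm) ((hω 1).monotone hm)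
    exact measure_mono (Icc_subset_Icc_right h1)
  refine lt_of_le_of_lt ((lintegral_mono_ae hliminf).trans
    ((lintegral_liminf_le (hmeas k)).trans ?_)) hKtop
  refine liminf_le_of_frequently_le' (Frequently.of_forall fun n => le_trans ?_ (hbound n))
  fin_cases k
  · exact le_self_add
  · exact le_add_self

/-! ### The renewal equation of the mean intensity -/

/-- The mean measure of a nonexploding point process with jumps of mean intensity `m` has density
`m`; consequently the mean intensities solve a linear Volterra equation. -/
theorem IsHawkesPriceModel.exists_meanIntensity {Ω : Type*} [mΩ : MeasurableSpace Ω]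
    {P : Measure Ω} [IsProbabilityMeasure P] {T : ℝ≥0} {μ₀ Δμ α₀ η β : ℝ}
    {τ : Fin 2 → ℕ → Ω → WithTop ℝ≥0} (h : IsHawkesPriceModel P T μ₀ Δμ α₀ η β τ)
    (hα₀ : 0 ≤ α₀) (hα₀' : α₀ < 1) (hη : 0 ≤ η) (hβ : 0 < β) :
    ∃ m : Fin 2 → ℝ≥0 → ℝ≥0∞, (∀ k, Measurable (m k)) ∧
      (∀ k, ∀ t ≤ T, ∫⁻ ω, countUpTo τ k t ω ∂P = ∫⁻ s in Icc 0 t, m k s ∂lebesgueNNReal) ∧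
      ∀ k, ∀ t ≤ T, m k t = ENNReal.ofReal (directionalBaseline μ₀ Δμ k 0) +
        ∫⁻ s in Ico 0 t, ENNReal.ofReal (quadraticRate α₀ η (t / T) *
          (β * Real.exp (-β * ((t : ℝ) - s)))) * m (1 - k) s ∂lebesgueNNReal := by
  have hfin := fun k => h.lintegral_countUpTo_lt_top hα₀ hα₀' hη hβ (le_refl T) k
  obtain ⟨𝓕, π, hπ, hτ, hjump, hN⟩ := h
  set L : Fin 2 → ℝ≥0 × Ω → ℝ≥0∞ := fun k p =>
    hawkesIntensity T (directionalBaseline μ₀ Δμ) (quadraticRate α₀ η) (antidiagExpKernel β)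
      (fun l => jumpMeasure fun n => τ l n p.2) k p.1 with hL
  have hLm : ∀ k, Measurable (L k) := fun k =>
    (measurable_predictable_hawkesIntensity hτ T (measurable_directionalBaseline μ₀ Δμ)
      (measurable_quadraticRate α₀ η) (measurable_antidiagExpKernel β) k).mono
        (predictable_le_prod 𝓕) le_rfl
  have hmm : ∀ k, Measurable fun s => ∫⁻ ω, L k (s, ω) ∂P := fun k => (hLm k).lintegral_prod_right'
  have h1 : ∀ k, ∀ t ≤ T, ∫⁻ ω, countUpTo τ k t ω ∂P =
      ∫⁻ s in Icc 0 t, ∫⁻ ω, L k (s, ω) ∂P ∂lebesgueNNReal := by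
    intro k t ht
    have h2 := lintegral_jumpMeasure_truncTime hπ hτ (measurable_directionalBaseline μ₀ Δμ)
      (measurable_quadraticRate α₀ η) (measurable_antidiagExpKernel β) hN k ht
        (isStoppingTime_top 𝓕)
    simp only [truncTime_top] at h2
    refine h2.trans ?_
    exact lintegral_lintegral_swap (f := fun ω s => L k (s, ω))
      ((hLm k).comp measurable_swap).aemeasurable
  refine ⟨fun k s => ∫⁻ ω, L k (s, ω) ∂P, hmm, h1, fun k t ht => ?_⟩
  set l := 1 - k
  have hNm := measurable_jumpMeasure (hτ l)
  -- up to the horizon, the mean measure of the jumps has density `m`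
  have hden : (P.bind fun ω => jumpMeasure fun n => τ l n ω).restrict (Iic T) =
      (lebesgueNNReal.withDensity fun s => ∫⁻ ω, L l (s, ω) ∂P).restrict (Iic T) := by
    have h3 : ∀ a : ℝ≥0, Iic a ∩ Iic T = Icc 0 (min a T) := by
      intro a
      ext x
      simp
    have h4 : ∀ a : ℝ≥0, (P.bind fun ω => jumpMeasure fun n => τ l n ω) (Icc 0 a) =
        ∫⁻ ω, countUpTo τ l a ω ∂P := fun a =>
      Measure.bind_apply measurableSet_Icc hNm.aemeasurable
    have hfm : IsFiniteMeasure ((P.bind fun ω => jumpMeasure fun n => τ l n ω).restrict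
        (Iic T)) := by
      refine ⟨?_⟩
      rw [Measure.restrict_apply MeasurableSet.univ, univ_inter,
        show Iic T = Icc 0 T by ext; simp, h4]
      exact hfin l
    refine Measure.ext_of_Iic _ _ fun a => ?_
    rw [Measure.restrict_apply measurableSet_Iic, Measure.restrict_apply measurableSet_Iic, h3, h4,
      withDensity_apply _ measurableSet_Icc, h1 l _ (min_le_right _ _)]
  have hsub : Ico 0 t ⊆ Iic T := fun x hx => hx.2.le.trans ht
  have hF : Measurable fun s : ℝ≥0 => ENNReal.ofReal (quadraticRate α₀ η (t / T) *
      (β * Real.exp (-β * ((t : ℝ) - s)))) := by fun_prop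
  simp only [hL, hawkesIntensity_directional]
  rw [lintegral_add_left measurable_const, lintegral_const, measure_univ, mul_one]
  congr 1
  calc ∫⁻ ω, ∫⁻ s in Ico 0 t, ENNReal.ofReal (quadraticRate α₀ η (t / T) *
          (β * Real.exp (-β * ((t : ℝ) - s)))) ∂(jumpMeasure fun n => τ l n ω) ∂P
      = ∫⁻ s in Ico 0 t, ENNReal.ofReal (quadraticRate α₀ η (t / T) *
          (β * Real.exp (-β * ((t : ℝ) - s)))) ∂(P.bind fun ω => jumpMeasure fun n => τ l n ω) := by
        simp only [← lintegral_indicator measurableSet_Ico]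
        rw [Measure.lintegral_bind hNm.aemeasurable (hF.indicator measurableSet_Ico).aemeasurable]
    _ = ∫⁻ s in Ico 0 t, ENNReal.ofReal (quadraticRate α₀ η (t / T) *
          (β * Real.exp (-β * ((t : ℝ) - s))))
            ∂(lebesgueNNReal.withDensity fun s => ∫⁻ ω, L l (s, ω) ∂P) := by
        rw [← Measure.restrict_restrict_of_subset hsub, hden,
          Measure.restrict_restrict_of_subset hsub]
    _ = _ := by
        rw [restrict_withDensity measurableSet_Ico,
          lintegral_withDensity_eq_lintegral_mul _ (hmm l) hF]
        refine lintegral_congr fun s => ?_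
        rw [Pi.mul_apply, mul_comm]
        simp only [hL, hawkesIntensity_directional]

/-- Integrals against `lebesgueNNReal` as integrals over the real line, where `f` is evaluated at
`x.toNNReal`. -/
theorem setLIntegral_Icc_lebesgueNNReal {f : ℝ≥0 → ℝ≥0∞} (hf : Measurable f) (t : ℝ≥0) :
    ∫⁻ s in Icc 0 t, f s ∂lebesgueNNReal = ∫⁻ x in Ioc (0 : ℝ) t, f x.toNNReal := by
  have h1 : ∫⁻ s in Icc 0 t, f s ∂lebesgueNNReal =
      ∫⁻ x in Iic (t : ℝ), f x.toNNReal ∂(lebesgueNNReal.map ((↑) : ℝ≥0 → ℝ)) := by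
    rw [setLIntegral_map (f := fun x : ℝ => f x.toNNReal) measurableSet_Iic
      (hf.comp measurable_real_toNNReal) NNReal.measurableEmbedding_coe.measurable]
    simp only [Real.toNNReal_coe]
    congr 2
    ext x
    simp
  rw [h1, map_coe_lebesgueNNReal, Measure.restrict_restrict measurableSet_Iic, inter_comm,
    Ici_inter_Iic]
  exact setLIntegral_congr Ioc_ae_eq_Icc.symm

theorem toReal_setLIntegral_lebesgueNNReal {f : ℝ≥0 → ℝ≥0∞} (hf : Measurable f) {t : ℝ≥0}
    (hfin : ∀ s ≤ t, f s < ∞) :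
    (∫⁻ s in Icc 0 t, f s ∂lebesgueNNReal).toReal =
      ∫ x in (0 : ℝ)..t, (f x.toNNReal).toReal := by
  rw [setLIntegral_Icc_lebesgueNNReal hf, intervalIntegral.integral_of_le t.coe_nonneg,
    integral_toReal]
  · fun_prop
  · refine (ae_restrict_iff' measurableSet_Ioc).2 (ae_of_all _ fun x hx => hfin _ ?_)
    exact Real.toNNReal_le_iff_le_coe.2 hx.2

/-- The real-valued mean intensity solves a Volterra equation on `[0,T]`, and its integral is the
mean number of jumps. -/
theorem IsHawkesPriceModel.exists_real_meanIntensity {Ω : Type*} [mΩ : MeasurableSpace Ω]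
    {P : Measure Ω} [IsProbabilityMeasure P] {T : ℝ≥0} {μ₀ Δμ α₀ η β : ℝ}
    {τ : Fin 2 → ℕ → Ω → WithTop ℝ≥0} (h : IsHawkesPriceModel P T μ₀ Δμ α₀ η β τ)
    (hμ₀ : 0 ≤ μ₀) (hΔμ : 0 < Δμ)
    (hα₀ : 0 ≤ α₀) (hα₀' : α₀ < 1) (hη : 0 ≤ η) (hη' : η ≤ 1) (hβ : 0 < β) :
    ∃ M : Fin 2 → ℝ → ℝ, (∀ k, IntervalIntegrable (M k) volume 0 T) ∧
      (∀ k, ∀ t ≤ T, (∫⁻ ω, countUpTo τ k t ω ∂P).toReal = ∫ x in (0 : ℝ)..t, M k x) ∧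
      ∀ k, ∀ t ∈ Icc (0 : ℝ) T, M k t = directionalBaseline μ₀ Δμ k 0 +
        quadraticRate α₀ η (t / T) *
          ∫ s in (0 : ℝ)..t, β * Real.exp (-β * (t - s)) * M (1 - k) s := by
  obtain ⟨m, hm, hcount, heq⟩ := h.exists_meanIntensity hα₀ hα₀' hη hβ
  have hcfin : ∀ k, ∫⁻ s in Icc 0 T, m k s ∂lebesgueNNReal ≠ ∞ := fun k =>
    (hcount k T le_rfl) ▸ (h.lintegral_countUpTo_lt_top hα₀ hα₀' hη hβ (le_refl T) k).ne
  have hfin : ∀ k, ∀ t ≤ T, m k t < ∞ := by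
    intro k t ht
    rw [heq k t ht]
    refine ENNReal.add_lt_top.2 ⟨ENNReal.ofReal_lt_top, ?_⟩
    refine lt_of_le_of_lt (b := ENNReal.ofReal (α₀ * β) *
      ∫⁻ s in Icc 0 T, m (1 - k) s ∂lebesgueNNReal) ?_
      (ENNReal.mul_lt_top ENNReal.ofReal_lt_top (hcfin _).lt_top)
    rw [← lintegral_const_mul _ (hm _)]
    refine (setLIntegral_mono' measurableSet_Ico fun s hs => ?_).trans
      (lintegral_mono_set fun x hx => ⟨hx.1, hx.2.le.trans ht⟩)
    gcongr
    · exact quadraticRate_le hα₀ hη _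
    · refine mul_le_of_le_one_right hβ.le (Real.exp_le_one_iff.2 ?_)
      have : (s : ℝ) ≤ t := by exact_mod_cast hs.2.le
      nlinarith
  refine ⟨fun k x => (m k x.toNNReal).toReal, fun k => ?_, fun k t ht => ?_, fun k t ht => ?_⟩
  · rw [intervalIntegrable_iff_integrableOn_Ioc_of_le T.coe_nonneg]
    refine integrable_toReal_of_lintegral_ne_top ?_ ?_
    · exact ((hm k).comp measurable_real_toNNReal).aemeasurable
    · rw [← setLIntegral_Icc_lebesgueNNReal (hm k)]
      exact hcfin k
  · rw [hcount k t ht]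
    exact toReal_setLIntegral_lebesgueNNReal (hm k) fun s hs => hfin k s (hs.trans ht)
  · lift t to ℝ≥0 using ht.1
    have htT : t ≤ T := by exact_mod_cast ht.2
    have hg : 0 ≤ quadraticRate α₀ η (t / T) :=
      quadraticRate_nonneg hα₀ hη' (by positivity) (div_le_one_of_le₀ ht.2 T.coe_nonneg)
    have hkfin : ∀ s ≤ t, ENNReal.ofReal (quadraticRate α₀ η (t / T) *
          (β * Real.exp (-β * ((t : ℝ) - s)))) * m (1 - k) s < ∞ := fun s hs =>
      ENNReal.mul_lt_top ENNReal.ofReal_lt_top (hfin _ s (hs.trans htT))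
    have hkm : Measurable fun s : ℝ≥0 => ENNReal.ofReal (quadraticRate α₀ η (t / T) *
          (β * Real.exp (-β * ((t : ℝ) - s)))) * m (1 - k) s :=
      Measurable.mul (by fun_prop) (hm _)
    have hb : 0 ≤ directionalBaseline μ₀ Δμ k 0 := by
      unfold directionalBaseline
      split_ifs <;> linarith
    have hIfin : ∫⁻ s in Ico 0 t, ENNReal.ofReal (quadraticRate α₀ η (t / T) *
          (β * Real.exp (-β * ((t : ℝ) - s)))) * m (1 - k) s ∂lebesgueNNReal ≠ ∞ :=
      ne_top_of_le_ne_top (hfin k t htT).ne ((heq k t htT).symm ▸ le_add_self)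
    simp only [Real.toNNReal_coe]
    rw [heq k t htT, ENNReal.toReal_add ENNReal.ofReal_ne_top hIfin, ENNReal.toReal_ofReal hb,
      setLIntegral_congr Ico_ae_eq_Icc, toReal_setLIntegral_lebesgueNNReal hkm hkfin,
      ← intervalIntegral.integral_const_mul]
    congr 1
    refine intervalIntegral.integral_congr fun x hx => ?_
    rw [uIcc_of_le t.coe_nonneg] at hx
    simp only [ENNReal.toReal_mul, Real.coe_toNNReal x hx.1]
    rw [ENNReal.toReal_ofReal (by positivity)]
    ring

/-- The difference of the mean intensities solves a scalar Volterra equation with a negative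
kernel, and its integral is the mean price increment. -/
theorem IsHawkesPriceModel.exists_meanDrift {Ω : Type*} [mΩ : MeasurableSpace Ω]
    {P : Measure Ω} [IsProbabilityMeasure P] {T : ℝ≥0} {μ₀ Δμ α₀ η β : ℝ}
    {τ : Fin 2 → ℕ → Ω → WithTop ℝ≥0} (h : IsHawkesPriceModel P T μ₀ Δμ α₀ η β τ)
    (hμ₀ : 0 ≤ μ₀) (hΔμ : 0 < Δμ)
    (hα₀ : 0 ≤ α₀) (hα₀' : α₀ < 1) (hη : 0 ≤ η) (hη' : η ≤ 1) (hβ : 0 < β) :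
    ∃ d : ℝ → ℝ, IntervalIntegrable d volume 0 T ∧
      (∀ t ≤ T, (∫⁻ ω, countUpTo τ 0 t ω ∂P).toReal - (∫⁻ ω, countUpTo τ 1 t ω ∂P).toReal =
        ∫ x in (0 : ℝ)..t, d x) ∧
      ∀ t ∈ Icc (0 : ℝ) T, d t = Δμ - quadraticRate α₀ η (t / T) *
        ∫ s in (0 : ℝ)..t, β * Real.exp (-β * (t - s)) * d s := by
  obtain ⟨M, hM, hcount, heq⟩ := h.exists_real_meanIntensity hμ₀ hΔμ hα₀ hα₀' hη hη' hβ
  have hMt : ∀ k, ∀ t ∈ Icc (0 : ℝ) T, IntervalIntegrable (M k) volume 0 t := fun k t ht =>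
    (hM k).mono_set (by
      rw [uIcc_of_le ht.1, uIcc_of_le T.coe_nonneg]
      exact Icc_subset_Icc_right ht.2)
  refine ⟨fun x => M 0 x - M 1 x, (hM 0).sub (hM 1), fun t ht => ?_, fun t ht => ?_⟩
  · have ht' : (t : ℝ) ∈ Icc (0 : ℝ) T := ⟨t.2, by exact_mod_cast ht⟩
    rw [hcount 0 t ht, hcount 1 t ht, intervalIntegral.integral_sub (hMt 0 t ht') (hMt 1 t ht')]
  · have hint : ∀ k, IntervalIntegrable (fun s => β * Real.exp (-β * (t - s)) * M k s)
        volume 0 t := fun k => (hMt k t ht).continuousOn_mul (by fun_prop)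
    have hsub : ∀ s, β * Real.exp (-β * (t - s)) * (M 0 s - M 1 s) =
      β * Real.exp (-β * (t - s)) * M 0 s - β * Real.exp (-β * (t - s)) * M 1 s :=
        fun s => mul_sub _ _ _
    simp only [hsub]
    rw [intervalIntegral.integral_sub (hint 0) (hint 1)]
    rw [heq 0 t ht, heq 1 t ht]
    simp only [directionalBaseline, sub_zero, sub_self, if_true, one_ne_zero, if_false]
    ring

/-! ### Asymptotics of the Volterra equation -/

theorem integral_expKernel (β t : ℝ) :
    ∫ s in (0 : ℝ)..t, β * Real.exp (-β * (t - s)) = 1 - Real.exp (-β * t) := by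
  have h1 : ∀ x ∈ uIcc 0 t, HasDerivAt (fun s => Real.exp (-β * (t - s)))
      (β * Real.exp (-β * (t - x))) x := by
    intro x _
    have h2 : HasDerivAt (fun s => -β * (t - s)) β x := by
      simpa using ((hasDerivAt_id x).const_sub t).const_mul (-β)
    simpa [mul_comm] using h2.exp
  rw [intervalIntegral.integral_eq_sub_of_hasDerivAt h1
    (Continuous.intervalIntegrable (by fun_prop) _ _)]
  simp

theorem abs_integral_expKernel_le {β t S : ℝ} (hβ : 0 < β) (ht : 0 ≤ t) (hS : 0 ≤ S) {d : ℝ → ℝ}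
    (hd : ∀ s ∈ Icc 0 t, |d s| ≤ S) :
    |∫ s in (0 : ℝ)..t, β * Real.exp (-β * (t - s)) * d s| ≤ S := by
  have h1 : ‖∫ s in (0 : ℝ)..t, β * Real.exp (-β * (t - s)) * d s‖ ≤
      ∫ s in (0 : ℝ)..t, β * Real.exp (-β * (t - s)) * S := by
    refine intervalIntegral.norm_integral_le_of_norm_le ht (ae_of_all _ fun s hs => ?_)
      (Continuous.intervalIntegrable (by fun_prop) _ _)
    rw [norm_mul, Real.norm_of_nonneg (by positivity)]
    exact mul_le_mul_of_nonneg_left (hd s ⟨hs.1.le, hs.2⟩) (by positivity)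
  rw [Real.norm_eq_abs, intervalIntegral.integral_mul_const, integral_expKernel] at h1
  refine h1.trans (mul_le_of_le_one_left hS ?_)
  linarith [Real.exp_pos (-β * t)]

/-- The solution of the Volterra equation with the exponential kernel is, after integration, within
`O(1)` of `Δμ / (1 + g)`, uniformly in the horizon. Indeed `y = ∫ φ(t - s) d(s) ds` solves
`y' = β (d - y)`, so that `d - Δμ / (1 + g) = h y' / β` with `h = g / (1 + g)`, and an integration
by parts moves the derivative to the slowly varying factor `h(t / T)`. -/
theorem abs_integral_sub_le_of_volterra {T t β α₀ η Δμ : ℝ} (hT : 0 < T) (ht : 0 ≤ t)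
    (htT : t ≤ T) (hβ : 0 < β) (hα₀ : 0 ≤ α₀) (hα₀' : α₀ < 1) (hη : 0 ≤ η) (hη' : η ≤ 1)
    (hΔμ : 0 < Δμ) {d : ℝ → ℝ} (hd : IntervalIntegrable d volume 0 T)
    (heq : ∀ x ∈ Icc 0 T, d x = Δμ - quadraticRate α₀ η (x / T) *
        ∫ s in (0 : ℝ)..x, β * Real.exp (-β * (x - s)) * d s) :
    |(∫ x in (0 : ℝ)..t, d x) - ∫ x in (0 : ℝ)..t, Δμ / (1 + quadraticRate α₀ η (x / T))| ≤
      3 * (Δμ / (1 - α₀)) / β := by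
  set g : ℝ → ℝ := fun x => quadraticRate α₀ η (x / T) with hg
  set y : ℝ → ℝ := fun x => ∫ s in (0 : ℝ)..x, β * Real.exp (-β * (x - s)) * d s with hy
  have hy' : ∀ x, y x = Real.exp (-β * x) * ∫ s in (0 : ℝ)..x, β * Real.exp (β * s) * d s := by
    intro x
    rw [hy, ← intervalIntegral.integral_const_mul]
    refine intervalIntegral.integral_congr fun s _ => ?_
    have : Real.exp (-β * (x - s)) = Real.exp (-β * x) * Real.exp (β * s) := by
      rw [← Real.exp_add]
      ring_nf
    simp only [this]
    ring
  have hint : IntervalIntegrable (fun s => β * Real.exp (β * s) * d s) volume 0 T :=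
    hd.continuousOn_mul (by fun_prop)
  have hyc : ContinuousOn y (Icc 0 T) := by
    have h1 := intervalIntegral.continuousOn_primitive_interval' hint left_mem_uIcc
    rw [uIcc_of_le hT.le] at h1
    have h2 : y = fun x => Real.exp (-β * x) * ∫ s in (0 : ℝ)..x, β * Real.exp (β * s) * d s :=
      funext hy'
    rw [h2]
    exact ContinuousOn.mul (by fun_prop) h1
  have hgc : Continuous g := by
    simp only [hg, quadraticRate]
    fun_prop
  have hg0 : ∀ x ∈ Icc 0 T, 0 ≤ g x := fun x hx =>
    quadraticRate_nonneg hα₀ hη' (div_nonneg hx.1 hT.le) (div_le_one_of_le₀ hx.2 hT.le)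
  have hg1 : ∀ x, g x ≤ α₀ := fun x => quadraticRate_le hα₀ hη _
  -- the equation itself upgrades the integrability of `d` to continuity
  have hdc : ContinuousOn d (Icc 0 T) :=
    (continuousOn_const.sub (hgc.continuousOn.mul hyc)).congr heq
  -- the sup norm of `y` is at most `Δμ / (1 - α₀)`
  obtain ⟨S, hS, hyS⟩ : ∃ S, S ≤ Δμ / (1 - α₀) ∧ ∀ x ∈ Icc 0 T, |y x| ≤ S := by
    obtain ⟨x₀, hx₀, hmax⟩ := isCompact_Icc.exists_isMaxOn ⟨0, left_mem_Icc.2 hT.le⟩ hyc.abs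
    have hmax' : ∀ x ∈ Icc 0 T, |y x| ≤ |y x₀| := fun x hx => hmax hx
    refine ⟨|y x₀|, ?_, hmax'⟩
    have h1 : ∀ s ∈ Icc 0 x₀, |d s| ≤ Δμ + α₀ * |y x₀| := by
      intro s hs
      have hsT : s ∈ Icc 0 T := ⟨hs.1, hs.2.trans hx₀.2⟩
      rw [heq s hsT]
      refine (abs_sub _ _).trans ?_
      rw [abs_of_pos hΔμ, abs_mul, abs_of_nonneg (hg0 s hsT)]
      exact add_le_add le_rfl (mul_le_mul (hg1 s) (hmax' s hsT) (abs_nonneg _) hα₀)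
    have h2 : |y x₀| ≤ Δμ + α₀ * |y x₀| :=
      abs_integral_expKernel_le hβ hx₀.1 (by positivity) h1
    rw [le_div_iff₀ (by linarith)]
    linarith
  have hS0 : 0 ≤ S := (abs_nonneg _).trans (hyS 0 (left_mem_Icc.2 hT.le))
  have hyderiv : ∀ x ∈ Ioo 0 T, HasDerivAt y (β * (d x - y x)) x := by
    intro x hx
    have hdx : ContinuousAt d x := hdc.continuousAt (Icc_mem_nhds hx.1 hx.2)
    have hc : ContinuousOn (fun s => β * Real.exp (β * s) * d s) (Ioo 0 T) :=
      ContinuousOn.mul (by fun_prop) (hdc.mono Ioo_subset_Icc_self)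
    have h1 : HasDerivAt (fun u => ∫ s in (0 : ℝ)..u, β * Real.exp (β * s) * d s)
        (β * Real.exp (β * x) * d x) x := by
      refine intervalIntegral.integral_hasDerivAt_right (hint.mono_set ?_) ?_ ?_
      · rw [uIcc_of_le hx.1.le, uIcc_of_le hT.le]
        exact Icc_subset_Icc_right hx.2.le
      · exact hc.stronglyMeasurableAtFilter isOpen_Ioo _ hx
      · exact hc.continuousAt (Ioo_mem_nhds hx.1 hx.2)
    have h2 : HasDerivAt (fun u => Real.exp (-β * u)) (Real.exp (-β * x) * -β) x := by
      have h3 : HasDerivAt (fun u => -β * u) (-β) x := by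
        simpa using (hasDerivAt_id x).const_mul (-β)
      exact h3.exp
    have h4 := h2.mul h1
    have h5 : y = fun x => Real.exp (-β * x) * ∫ s in (0 : ℝ)..x, β * Real.exp (β * s) * d s :=
      funext hy'
    rw [h5]
    refine h4.congr_deriv ?_
    have h6 : Real.exp (-β * x) * Real.exp (β * x) = 1 := by
      rw [← Real.exp_add]
      simp
    simp only
    linear_combination (β * d x) * h6
  have hgderiv : ∀ x, HasDerivAt g (-(2 * α₀ * η * (x / T) / T)) x := by
    intro x
    have h1 : HasDerivAt (fun x : ℝ => x / T) (1 / T) x := (hasDerivAt_id x).div_const T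
    have h2 := (((h1.pow 2).const_mul η).const_sub 1).const_mul α₀
    refine h2.congr_deriv ?_
    push_cast
    ring
  have hpos : ∀ x ∈ Icc 0 T, 1 + g x ≠ 0 := fun x hx => by linarith [hg0 x hx]
  set H : ℝ → ℝ := fun x => g x / (1 + g x) * (y x / β) with hH
  -- `r` is the part of `H'` in which the derivative falls on the slowly varying factor
  set r : ℝ → ℝ := fun x => -(2 * α₀ * η * (x / T) / T) / (1 + g x) ^ 2 * (y x / β) with hr
  have hsub : Icc 0 t ⊆ Icc 0 T := Icc_subset_Icc_right htT
  have hHc : ContinuousOn H (Icc 0 t) :=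
    (ContinuousOn.mul (hgc.continuousOn.div (by fun_prop) hpos) (hyc.div_const β)).mono hsub
  have hrc : ContinuousOn r (Icc 0 t) := by
    refine (ContinuousOn.mul (ContinuousOn.div (by fun_prop) (by fun_prop) fun x hx =>
      pow_ne_zero 2 (hpos x hx)) (hyc.div_const β)).mono hsub
  have hqc : ContinuousOn (fun x => Δμ / (1 + g x)) (Icc 0 t) :=
    (continuousOn_const.div (by fun_prop) hpos).mono hsub
  have hHderiv : ∀ x ∈ Ioo 0 t, HasDerivAt H (r x + (d x - Δμ / (1 + g x))) x := by
    intro x hx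
    have hxT : x ∈ Ioo 0 T := ⟨hx.1, hx.2.trans_le htT⟩
    have hx' := hpos x (Ioo_subset_Icc_self hxT)
    have h1 := ((hgderiv x).div ((hgderiv x).const_add 1) hx').mul ((hyderiv x hxT).div_const β)
    refine h1.congr_deriv ?_
    have h2 : d x = Δμ - g x * y x := heq x (Ioo_subset_Icc_self hxT)
    simp only [hr, h2, Pi.div_apply]
    field_simp
    ring
  have hri : IntervalIntegrable r volume 0 t :=
    ContinuousOn.intervalIntegrable (by rwa [uIcc_of_le ht])
  have hqi : IntervalIntegrable (fun x => Δμ / (1 + g x)) volume 0 t :=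
    ContinuousOn.intervalIntegrable (by rwa [uIcc_of_le ht])
  have hdi : IntervalIntegrable d volume 0 t :=
    ContinuousOn.intervalIntegrable (by rw [uIcc_of_le ht]; exact hdc.mono hsub)
  have hftc := intervalIntegral.integral_eq_sub_of_hasDerivAt_of_le ht hHc hHderiv
    (hri.add (hdi.sub hqi))
  rw [intervalIntegral.integral_add hri (hdi.sub hqi), intervalIntegral.integral_sub hdi hqi]
    at hftc
  have hH0 : H 0 = 0 := by simp [hH, hy]
  have hHt : |H t| ≤ S / β := by
    have htt : t ∈ Icc 0 T := ⟨ht, htT⟩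
    have := hg0 t htt
    simp only [hH]
    rw [abs_mul, abs_div (y t), abs_of_pos hβ, abs_of_nonneg (by positivity)]
    refine (mul_le_of_le_one_left (by positivity) ?_).trans ?_
    · rw [div_le_one (by positivity)]
      linarith
    · gcongr
      exact hyS t htt
  have hrle : |∫ x in (0 : ℝ)..t, r x| ≤ 2 * (S / β) := by
    have h1 : ∀ x ∈ uIoc 0 t, ‖r x‖ ≤ 2 * (S / β) / T := by
      intro x hx
      rw [uIoc_of_le ht] at hx
      have hxT : x ∈ Icc 0 T := ⟨hx.1.le, hx.2.trans htT⟩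
      have hgx := hg0 x hxT
      have hxT' : x / T ≤ 1 := div_le_one_of_le₀ hxT.2 hT.le
      have hx0 : 0 ≤ x / T := div_nonneg hxT.1 hT.le
      simp only [hr]
      rw [Real.norm_eq_abs, abs_mul, abs_div, abs_div (y x), abs_of_pos hβ, abs_neg,
        abs_of_nonneg (by positivity), abs_of_nonneg (by positivity : 0 ≤ (1 + g x) ^ 2)]
      have h3 : 2 * α₀ * η * (x / T) ≤ 2 := by
        have h4 : α₀ * η ≤ 1 := mul_le_one₀ hα₀'.le hη hη'
        have h5 : α₀ * η * (x / T) ≤ 1 := mul_le_one₀ h4 hx0 hxT'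
        linarith
      calc 2 * α₀ * η * (x / T) / T / (1 + g x) ^ 2 * (|y x| / β)
          ≤ 2 / T / 1 * (S / β) := by
            gcongr
            · exact one_le_pow₀ (by linarith)
            · exact hyS x hxT
        _ = 2 * (S / β) / T := by ring
    have h2 := intervalIntegral.norm_integral_le_of_norm_le_const h1
    rw [Real.norm_eq_abs, sub_zero, abs_of_nonneg ht] at h2
    refine h2.trans ?_
    rw [div_mul_eq_mul_div, div_le_iff₀ hT]
    gcongr
  have hfin : (∫ x in (0 : ℝ)..t, d x) - ∫ x in (0 : ℝ)..t, Δμ / (1 + g x) =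
      H t - ∫ x in (0 : ℝ)..t, r x := by
    rw [hH0] at hftc
    linarith
  rw [hfin]
  refine (abs_sub _ _).trans ((add_le_add hHt hrle).trans ?_)
  rw [show S / β + 2 * (S / β) = 3 * S / β by ring]
  gcongr

theorem tendsto_of_abs_sub_mul_le {f : ℝ≥0 → ℝ} {A K : ℝ}
    (h : ∀ T : ℝ≥0, 0 < T → |f T - T * A| ≤ K) :
    Tendsto (fun T : ℝ≥0 => f T / T) atTop (𝓝 A) := by
  refine tendsto_iff_norm_sub_tendsto_zero.2 ?_
  have h1 : Tendsto (fun T : ℝ≥0 => K / (T : ℝ)) atTop (𝓝 0) :=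
    tendsto_const_nhds.div_atTop (NNReal.tendsto_coe_atTop.2 tendsto_id)
  refine squeeze_zero' (Eventually.of_forall fun _ => norm_nonneg _) ?_ h1
  filter_upwards [eventually_gt_atTop 0] with T hT
  have hT' : (0 : ℝ) < T := hT
  rw [le_div_iff₀ hT', Real.norm_eq_abs]
  nth_rw 2 [← abs_of_pos hT']
  rw [← abs_mul, sub_mul, div_mul_cancel₀ _ hT'.ne', mul_comm A]
  exact h T hT

/-! ### The limiting ratio -/

theorem hasDerivAt_artanh {x : ℝ} (hx : x ∈ Ioo (-1 : ℝ) 1) :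
    HasDerivAt Real.artanh (1 / (1 - x ^ 2)) x := by
  have h1 : 0 < 1 + x := by linarith [hx.1]
  have h2 : 0 < 1 - x := by linarith [hx.2]
  have h3 : HasDerivAt (fun x : ℝ => 1 / 2 * (Real.log (1 + x) - Real.log (1 - x)))
      (1 / 2 * (1 / (1 + x) - (-1) / (1 - x))) x :=
    ((((hasDerivAt_id x).const_add 1).log h1.ne').sub
      (((hasDerivAt_id x).const_sub 1).log h2.ne')).const_mul _
  have h4 : 1 - x ^ 2 ≠ 0 := by
    rw [show 1 - x ^ 2 = (1 + x) * (1 - x) by ring]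
    positivity
  refine (h3.congr_of_eventuallyEq ?_).congr_deriv ?_
  · filter_upwards [Ioo_mem_nhds hx.1 hx.2] with z hz
    rw [Real.artanh_eq_half_log (Ioo_subset_Icc_self hz), Real.log_div]
    · linarith [hz.1]
    · linarith [hz.2]
  · field_simp
    ring

theorem integral_div_one_add_quadraticRate {α₀ η Δμ u : ℝ} (hα₀ : 0 ≤ α₀)
    (hη : 0 ≤ η) (hη' : η ≤ 1) (hu : 0 < u) (hu' : u ≤ 1) :
    ∫ x in (0 : ℝ)..u, Δμ / (1 + quadraticRate α₀ η x) =
      Δμ * u / (1 + α₀) * artanhQuotient (√(α₀ * η / (1 + α₀)) * u) := by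
  set ζ := α₀ * η / (1 + α₀) with hζ
  have hα1 : 0 < 1 + α₀ := by linarith
  have hζ0 : 0 ≤ ζ := by positivity
  have hζ1 : ζ < 1 := by
    rw [hζ, div_lt_one hα1]
    nlinarith
  have hrw : ∀ x, Δμ / (1 + quadraticRate α₀ η x) =
      Δμ / (1 + α₀) * (1 / (1 - (√ζ * x) ^ 2)) := by
    intro x
    rw [mul_pow, Real.sq_sqrt hζ0, div_mul_div_comm, mul_one]
    congr 1
    rw [hζ, quadraticRate]
    field_simp
    ring
  simp only [hrw]
  rw [intervalIntegral.integral_const_mul]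
  rcases hζ0.eq_or_lt with h0 | h0
  · rw [← h0]
    simp [artanhQuotient]
    ring
  · have hs : 0 < √ζ := Real.sqrt_pos.2 h0
    have hs1 : √ζ < 1 := by rw [Real.sqrt_lt' one_pos]; simpa using hζ1
    have hmem : ∀ x ∈ uIcc 0 u, √ζ * x ∈ Ioo (-1 : ℝ) 1 := by
      intro x hx
      rw [uIcc_of_le hu.le] at hx
      have h1 : 0 ≤ √ζ * x := mul_nonneg hs.le hx.1
      exact ⟨by linarith, mul_lt_one_of_nonneg_of_lt_one_left hs.le hs1 (hx.2.trans hu')⟩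
    have hder : ∀ x ∈ uIcc 0 u, HasDerivAt (fun x => Real.artanh (√ζ * x) / √ζ)
        (1 / (1 - (√ζ * x) ^ 2)) x := by
      intro x hx
      have h1 : HasDerivAt (fun x => √ζ * x) (√ζ) x := by
        simpa using (hasDerivAt_id x).const_mul (√ζ)
      refine (((hasDerivAt_artanh (hmem x hx)).comp x h1).div_const (√ζ)).congr_deriv ?_
      field_simp
    have hcont : ContinuousOn (fun x : ℝ => 1 / (1 - (√ζ * x) ^ 2)) (uIcc 0 u) := by
      refine continuousOn_const.div (by fun_prop) fun x hx => ?_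
      have := hmem x hx
      nlinarith [this.1, this.2]
    rw [intervalIntegral.integral_eq_sub_of_hasDerivAt hder hcont.intervalIntegrable]
    have hne : √ζ * u ≠ 0 := by positivity
    rw [artanhQuotient, if_neg hne, mul_zero, Real.artanh_zero]
    field_simp
    ring

/-- The mean price increment over `[0, Tu]` is `T ∫₀ᵘ Δμ / (1 + α(x)) dx + O(1)`. -/
theorem IsHawkesPriceModel.abs_integral_price_sub_le {Ω : Type*} [mΩ : MeasurableSpace Ω]
    {P : Measure Ω} [IsProbabilityMeasure P] {T : ℝ≥0} {μ₀ Δμ α₀ η β : ℝ}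
    {τ : Fin 2 → ℕ → Ω → WithTop ℝ≥0} (h : IsHawkesPriceModel P T μ₀ Δμ α₀ η β τ) (hT : 0 < T)
    (hμ₀ : 0 ≤ μ₀) (hΔμ : 0 < Δμ)
    (hα₀ : 0 ≤ α₀) (hα₀' : α₀ < 1) (hη : 0 ≤ η) (hη' : η ≤ 1) (hβ : 0 < β) {u : ℝ≥0}
    (hu : 0 < u) (hu' : u ≤ 1) :
    Integrable (fun ω => price τ (T * u) ω - price τ 0 ω) P ∧
      |∫ ω, (price τ (T * u) ω - price τ 0 ω) ∂P -
        T * (Δμ * u / (1 + α₀) * artanhQuotient (√(α₀ * η / (1 + α₀)) * u))| ≤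
          3 * (Δμ / (1 - α₀)) / β := by
  have htT : T * u ≤ T := mul_le_of_le_one_right zero_le hu'
  have hfin := h.lintegral_countUpTo_lt_top hα₀ hα₀' hη hβ htT
  obtain ⟨d, hd, hcount, heq⟩ := h.exists_meanDrift hμ₀ hΔμ hα₀ hα₀' hη hη' hβ
  obtain ⟨𝓕, π, hπ, hτ, hjump, -⟩ := h
  have hmeas : ∀ k, Measurable (countUpTo τ k (T * u)) := fun k =>
    (Measure.measurable_coe measurableSet_Icc).comp (measurable_jumpMeasure (hτ k))
  have hint : ∀ k, Integrable (fun ω => (countUpTo τ k (T * u) ω).toReal) P := fun k =>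
    integrable_toReal_of_lintegral_ne_top (hmeas k).aemeasurable (hfin k).ne
  have hae : (fun ω => price τ (T * u) ω - price τ 0 ω) =ᵐ[P]
      fun ω => (countUpTo τ 0 (T * u) ω).toReal - (countUpTo τ 1 (T * u) ω).toReal := by
    filter_upwards [hjump] with ω hω
    simp only [price, countUpTo, (hω 0).jumpMeasure_Icc_zero, (hω 1).jumpMeasure_Icc_zero,
      ENNReal.toReal_zero, sub_zero]
  refine ⟨((hint 0).sub (hint 1)).congr hae.symm, ?_⟩
  have hint' : ∀ k, ∫ ω, (countUpTo τ k (T * u) ω).toReal ∂P =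
      (∫⁻ ω, countUpTo τ k (T * u) ω ∂P).toReal := fun k =>
    integral_toReal (hmeas k).aemeasurable (ae_lt_top (hmeas k) (hfin k).ne)
  rw [integral_congr_ae hae, integral_sub (hint 0) (hint 1), hint' 0, hint' 1, hcount _ htT]
  have hT' : (0 : ℝ) < T := hT
  have hlim : ∫ x in (0 : ℝ)..(T * u : ℝ≥0), Δμ / (1 + quadraticRate α₀ η (x / T)) =
      T * (Δμ * u / (1 + α₀) * artanhQuotient (√(α₀ * η / (1 + α₀)) * u)) := by
    rw [intervalIntegral.integral_comp_div (fun x => Δμ / (1 + quadraticRate α₀ η x)) hT'.ne',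
      zero_div, NNReal.coe_mul, mul_div_cancel_left₀ _ hT'.ne', smul_eq_mul,
      integral_div_one_add_quadraticRate hα₀ hη hη' (NNReal.coe_pos.2 hu) (by exact_mod_cast hu')]
  rw [← hlim]
  exact abs_integral_sub_le_of_volterra hT' (NNReal.coe_nonneg _) (by exact_mod_cast htT) hβ hα₀
    hα₀' hη hη' hΔμ hd heq


theorem mainTheorem5 {Ω : Type*} [MeasurableSpace Ω] (P : Measure Ω) [IsProbabilityMeasure P]
    (μ₀ Δμ α₀ η β : ℝ) (hμ₀ : 0 ≤ μ₀) (hΔμ : 0 < Δμ) (hα₀ : 0 ≤ α₀) (hα₀' : α₀ < 1)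
    (hη : 0 ≤ η) (hη' : η ≤ 1) (hβ : 0 < β)
    (τ τ₀ : ℝ≥0 → Fin 2 → ℕ → Ω → WithTop ℝ≥0)
    (hτ : ∀ T : ℝ≥0, 0 < T → IsHawkesPriceModel P T μ₀ Δμ α₀ η β (τ T))
    (hτ₀ : ∀ T : ℝ≥0, 0 < T → IsHawkesPriceModel P T μ₀ Δμ α₀ 0 β (τ₀ T))
    (u : ℝ≥0) (hu : 0 < u) (hu' : u ≤ 1) :
    (∀ T : ℝ≥0, 0 < T →
      (∀ k, ∫⁻ ω, countUpTo (τ T) k (T * u) ω ∂P < ∞) ∧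
      (∀ k, ∫⁻ ω, countUpTo (τ₀ T) k (T * u) ω ∂P < ∞) ∧
      Integrable (fun ω => price (τ T) (T * u) ω - price (τ T) 0 ω) P ∧
      Integrable (fun ω => price (τ₀ T) (T * u) ω - price (τ₀ T) 0 ω) P) ∧
    Tendsto
      (fun T : ℝ≥0 =>
        (∫ ω, (price (τ T) (T * u) ω - price (τ T) 0 ω) ∂P) /
          (∫ ω, (price (τ₀ T) (T * u) ω - price (τ₀ T) 0 ω) ∂P))
      atTop (𝓝 (artanhQuotient (√(α₀ * η / (1 + α₀)) * u))) := by
  have key := fun T hT => (hτ T hT).abs_integral_price_sub_le hT hμ₀ hΔμ hα₀ hα₀' hη hη' hβ hu hu'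
  have key₀ := fun T hT =>
    (hτ₀ T hT).abs_integral_price_sub_le hT hμ₀ hΔμ hα₀ hα₀' le_rfl zero_le_one hβ hu hu'
  refine ⟨fun T hT => ?_, ?_⟩
  · have htT : T * u ≤ T := mul_le_of_le_one_right zero_le hu'
    exact ⟨fun k => (hτ T hT).lintegral_countUpTo_lt_top hα₀ hα₀' hη hβ htT k,
      fun k => (hτ₀ T hT).lintegral_countUpTo_lt_top hα₀ hα₀' le_rfl hβ htT k,
      (key T hT).1, (key₀ T hT).1⟩
  · have h1 := tendsto_of_abs_sub_mul_le fun T hT => (key T hT).2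
    have h2 := tendsto_of_abs_sub_mul_le fun T hT => (key₀ T hT).2
    have hu₀ : (0 : ℝ) < u := hu
    have hα1 : 0 < 1 + α₀ := by linarith
    have hc : Δμ * u / (1 + α₀) ≠ 0 := by positivity
    have hq : artanhQuotient (√(α₀ * 0 / (1 + α₀)) * u) = 1 := by simp [artanhQuotient]
    rw [hq, mul_one] at h2
    have h3 := h1.div h2 hc
    rw [mul_div_cancel_left₀ _ hc] at h3
    refine h3.congr' ?_
    filter_upwards [eventually_gt_atTop 0] with T hT
    have hT' : (T : ℝ) ≠ 0 := by exact_mod_cast hT.ne'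
    exact div_div_div_cancel_right₀ hT' _ _
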